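/- Let $N$ be a complete, simply-connected Riemannian surface of constant curvature $\kappa \le 0$ (so that $N$ is diffeomorphic to $\mathbb{R}^2$), and let $\Omega, \tilde\Omega \subset N$ be compact strictly convex domains with smooth boundary (i.e. closures of bounded connected open sets, whose boundaries are smooth with positive curvature with respect to the outward normal). Let $h : \Omega \to \mathbb{R}$ be a smooth function (up to the boundary) that is uniformly convex, that is, $(\mathrm{Hess}\, h)_p(w,w) \ge \theta |w|^2$ for some $\theta > 0$ and all $p \in \Omega$, $w \in T_pN$, and that satisfies $h(p) = 0$ and $|\nabla h(p)| = 1$ for all $p \in \partial\Omega$; let $\tilde h : \tilde\Omega \to \mathbb{R}$ be a function with the same properties on $\tilde\Omega$. A diffeomorphism $f : \Omega \to \tilde\Omega$ (smooth up to the boundary, with smooth inverse) is called minimal Lagrangian if it is area-preserving and orientation-preserving and its graph $\{(p,f(p)) : p \in \Omega\}$ is a minimal submanifold of the Riemannian product $N \times N$. Then there exists a constant $C_3$, depending only on $h$ and $\tilde h$ (in particular not on $f$ or $p$), such that for every minimal Lagrangian diffeomorphism $f : \Omega \to \tilde\Omega$ and every boundary point $p \in \partial\Omega$, $$\det(I +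 Df_p^* \, Df_p) \le C_3,$$ where $Df_p^* : T_{f(p)}N \to T_pN$ is the adjoint of $Df_p$ with respect to the metric of $N$. -/

import Mathlib

open scoped ContDiff Matrix

noncomputable section

namespace MinLag

/-- The underlying smooth surface of `N`, in a global coordinate system. Only its topology, its
smooth structure and its Lebesgue measure are used; lengths are always measured by a Riemannian
metric. -/
abbrev Plane := Fin 2 → ℝ

/-- The partial derivative `∂ᵢ φ (x)`. -/
def pd (i : Fin 2) (φ : Plane → ℝ) (x : Plane) : ℝ := fderiv ℝ φ x (Pi.single i 1)

/-- A smooth Riemannian metric on the plane, given by its coefficients `g_{ij}`. -/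
structure Metric where
  coeff : Plane → Matrix (Fin 2) (Fin 2) ℝ
  smooth : ∀ i j, ContDiff ℝ ∞ (fun x => coeff x i j)
  posDef : ∀ x, (coeff x).PosDef

/-- The inner product `⟨v, w⟩` on the tangent space at `x`. -/
def Metric.inner (g : Metric) (x v w : Plane) : ℝ := v ⬝ᵥ (g.coeff x *ᵥ w)

/-- The length `|v|` of a tangent vector at `x`. -/
def Metric.len (g : Metric) (x v : Plane) : ℝ := √(g.inner x v v)

/-- The Christoffel symbol `Γ^k_{ij}` of the Levi-Civita connection. -/
def Metric.christoffel (g : Metric) (k i j : Fin 2) (x : Plane) : ℝ :=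
  (1 / 2) * ∑ l, (g.coeff x)⁻¹ k l *
    (pd i (fun y => g.coeff y j l) x + pd j (fun y => g.coeff y i l) x
      - pd l (fun y => g.coeff y i j) x)

/-- The vector `Γ_x(v, w)`, i.e. the covariant derivative at `x`, in the direction `v`, of the
vector field with constant components `w`. -/
def Metric.gamma (g : Metric) (x v w : Plane) : Plane :=
  fun k => ∑ i, ∑ j, g.christoffel k i j x * v i * w j

/-- The components `R^l_{kij}` of the curvature tensor, `R(∂ᵢ, ∂ⱼ) ∂ₖ = ∑ R^l_{kij} ∂ₗ`, where
`R(X, Y) Z = ∇_X ∇_Y Z - ∇_Y ∇_X Z - ∇_{[X, Y]} Z`. -/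
def Metric.riem (g : Metric) (l k i j : Fin 2) (x : Plane) : ℝ :=
  pd i (g.christoffel l j k) x - pd j (g.christoffel l i k) x
    + ∑ m, (g.christoffel l i m x * g.christoffel m j k x
      - g.christoffel l j m x * g.christoffel m i k x)

/-- The Gauss curvature `⟨R(∂₁, ∂₂) ∂₂, ∂₁⟩ / det g`. -/
def Metric.gaussCurvature (g : Metric) (x : Plane) : ℝ :=
  (∑ l, g.coeff x l 0 * g.riem l 1 0 1 x) / (g.coeff x).det

/-- The length of the curve `γ` on `[0, 1]`. -/
def Metric.pathLength (g : Metric) (γ : ℝ → Plane) : ℝ :=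
  ∫ t in (0 : ℝ)..1, g.len (γ t) (deriv γ t)

/-- The Riemannian distance. -/
def Metric.rdist (g : Metric) (x y : Plane) : ℝ :=
  sInf {L | ∃ γ : ℝ → Plane, ContDiff ℝ 1 γ ∧ γ 0 = x ∧ γ 1 = y ∧ L = g.pathLength γ}

/-- Completeness of the Riemannian distance: every Cauchy sequence converges. -/
def Metric.IsComplete (g : Metric) : Prop :=
  ∀ u : ℕ → Plane, (∀ ε > 0, ∃ n₀, ∀ m ≥ n₀, ∀ n ≥ n₀, g.rdist (u m) (u n) < ε) →
    ∃ x, Filter.Tendsto (fun n => g.rdist (u n) x) Filter.atTop (nhds 0)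

/-- `(ℝ², g)` is a complete (simply connected) surface of constant curvature `κ ≤ 0`. -/
def Metric.IsSpaceForm (g : Metric) (κ : ℝ) : Prop :=
  κ ≤ 0 ∧ g.IsComplete ∧ ∀ x, g.gaussCurvature x = κ

/-- The Riemannian area measure `√(det g) dx`. -/
def Metric.area (g : Metric) : MeasureTheory.Measure Plane :=
  MeasureTheory.volume.withDensity (fun x => ENNReal.ofReal √(g.coeff x).det)

/-- The gradient `∇h`. -/
def Metric.grad (g : Metric) (h : Plane → ℝ) (x : Plane) : Plane :=
  fun k => ∑ l, (g.coeff x)⁻¹ k l * pd l h x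

/-- The Riemannian Hessian `(Hess h)_x(v, w)`. -/
def Metric.hess (g : Metric) (h : Plane → ℝ) (x v w : Plane) : ℝ :=
  ∑ i, ∑ j, (pd i (pd j h) x - ∑ k, g.christoffel k i j x * pd k h x) * v i * w j

/-- Smoothness up to the boundary on a closed set, i.e. smoothness on an open neighbourhood. -/
def SmoothNear {F : Type*} [NormedAddCommGroup F] [NormedSpace ℝ F]
    (φ : Plane → F) (Ω : Set Plane) : Prop :=
  ∃ U, IsOpen U ∧ Ω ⊆ U ∧ ContDiffOn ℝ ∞ φ U

/-- `Ω` is (the closure of) a bounded, strictly convex domain with smooth boundary: near each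
boundary point it is a sublevel set `{ρ ≤ 0}` of a smooth function with `dρ ≠ 0`, and the second
fundamental form of the boundary is positive there. -/
structure IsStrictlyConvexDomain (g : Metric) (Ω : Set Plane) : Prop where
  compact : IsCompact Ω
  connected : IsConnected (interior Ω)
  boundary : ∀ p ∈ frontier Ω, ∃ (U : Set Plane) (ρ : Plane → ℝ),
    IsOpen U ∧ p ∈ U ∧ ContDiffOn ℝ ∞ ρ U ∧ Ω ∩ U = {x ∈ U | ρ x ≤ 0} ∧
    fderiv ℝ ρ p ≠ 0 ∧ ∀ v, v ≠ 0 → fderiv ℝ ρ p v = 0 → 0 < g.hess ρ p v v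

/-- `h` is a uniformly convex boundary defining function of `Ω`. -/
structure IsBoundaryDefining (g : Metric) (Ω : Set Plane) (h : Plane → ℝ) : Prop where
  smooth : SmoothNear h Ω
  uniformlyConvex : ∃ θ > 0, ∀ p ∈ Ω, ∀ w, θ * g.inner p w w ≤ g.hess h p w w
  zero : ∀ p ∈ frontier Ω, h p = 0
  grad : ∀ p ∈ frontier Ω, g.len p (g.grad h p) = 1

/-- The matrix of the differential `Df_x` in coordinates. -/
def jac (f : Plane → Plane) (x : Plane) : Matrix (Fin 2) (Fin 2) ℝ :=
  fun k i => pd i (fun y => f y k) x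

/-- The matrix of the adjoint `Df_x^* : T_{f(x)} N → T_x N` with respect to the inner products
on these tangent spaces. -/
def Metric.jacAdj (g : Metric) (f : Plane → Plane) (x : Plane) : Matrix (Fin 2) (Fin 2) ℝ :=
  (g.coeff x)⁻¹ * (jac f x)ᵀ * g.coeff (f x)

/-- The product metric of `M = N × N` at `(p, q)`. -/
def Metric.prodInner (g : Metric) (p q : Plane) (V W : Plane × Plane) : ℝ :=
  g.inner p V.1 W.1 + g.inner q V.2 W.2

/-- The tangent vector `(v, Df_p(v))` to the graph of `f` at `(p, f(p))`. -/
def graphTangent (f : Plane → Plane) (p v : Plane) : Plane × Plane := (v, jac f p *ᵥ v)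

/-- The covariant derivative `∇^M_V W` at `(p, f(p))`, in the product `M = N × N`, of the tangent
fields `V = (v, Df(v))` and `W = (w, Df(w))` of the graph, where `v`, `w` have constant
components. Its normal part is the second fundamental form of the graph. -/
def Metric.graphNabla (g : Metric) (f : Plane → Plane) (p v w : Plane) : Plane × Plane :=
  (g.gamma p v w,
    (fun k => ∑ i, ∑ j, pd i (pd j (fun y => f y k)) p * v i * w j)
      + g.gamma (f p) (jac f p *ᵥ v) (jac f p *ᵥ w))

/-- The graph of `f` over `Ω` is a minimal submanifold of `N × N`: for an orthonormal basis
`e₁, e₂` of its tangent space, `II(e₁, e₁) + II(e₂, e₂)` vanishes, i.e. the vector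
`∇_{e₁} e₁ + ∇_{e₂} e₂` is orthogonal to every normal vector `ν`. -/
def Metric.IsMinimalGraph (g : Metric) (f : Plane → Plane) (Ω : Set Plane) : Prop :=
  ∀ p ∈ Ω, ∀ e : Fin 2 → Plane,
    (∀ i j, g.prodInner p (f p) (graphTangent f p (e i)) (graphTangent f p (e j))
      = if i = j then 1 else 0) →
    ∀ ν : Plane × Plane, (∀ v, g.prodInner p (f p) ν (graphTangent f p v) = 0) →
      g.prodInner p (f p) (∑ i, g.graphNabla f p (e i) (e i)) ν = 0

/-- `f` restricts to a diffeomorphism, smooth up to the boundary, from `Ω` to `Ω'`. -/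
def IsDiffeo (f : Plane → Plane) (Ω Ω' : Set Plane) : Prop :=
  SmoothNear f Ω ∧ ∃ f' : Plane → Plane, SmoothNear f' Ω' ∧
    Set.MapsTo f Ω Ω' ∧ Set.MapsTo f' Ω' Ω ∧ Set.InvOn f' f Ω Ω'

/-- `f : Ω → Ω'` is a minimal Lagrangian diffeomorphism. -/
structure IsMinimalLagrangianDiffeo (g : Metric) (f : Plane → Plane) (Ω Ω' : Set Plane) :
    Prop where
  diffeo : IsDiffeo f Ω Ω'
  areaPreserving : ∀ A ⊆ Ω, MeasurableSet A → g.area (f '' A) = g.area A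
  orientationPreserving : ∀ p ∈ Ω, 0 < (jac f p).det
  minimal : g.IsMinimalGraph f Ω

end MinLag

end

noncomputable section

namespace MinLag

open Filter Topology MeasureTheory

/-! ### Partial derivatives -/

/-! In orthonormal frames `Df` becomes a matrix `F` (`diffMatrix`), and preservation of area and
orientation gives `det F = 1`. Write `F = R P` with `R` a rotation and `P` positive symmetric. Then
`tr P` is `confAbs` and `det (1 + FᵀF) = 2 + |F|² = (tr P)²`, so the task is to bound `tr P` along
the boundary.

Interior. The operator `lap`, taken in an orthonormal basis of the graph, is a trace of second
derivatives. Minimality says that `f` is harmonic for it (`IsAdapted.lap_map`). Since `det F = 1`,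
the projections of the basis to each factor have total squared length 1, so uniform convexity gives
`lap h ≥ θ` and `lap (h' ∘ f) ≥ θ'`. The key fact is that `R` is parallel (`fderiv_rot`), a
consequence of an algebraic identity between `det F = 1` and minimality
(`conformal_arg_stationary`). Hence every smooth function of `(x, f x, R)` has `lap` bounded above
independently of `f`, however large `Df` is (`exists_lap_bound`). Subtracting a large multiple of
`h` or `h' ∘ f` makes it a strict supersolution, to which the minimum principle applies.

Boundary. Let `ν`, `ν'` be the unit gradients of `h` at `p` and of `h'` at `f p`. Comparing `h` with
`h' ∘ f` in both directions gives `Fᵀν' = b ν` with `b` and `1 / b` bounded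
(`exists_boundary_ratio`). Since `(tr P) R = F + F⁻ᵀ`, pairing with `ν` and `ν'` yields `(tr P) χ =
b + 1 / b`, where `χ = ⟨Rν, ν'⟩` is the obliqueness (`confAbs_mul_obliqueness`). It remains to bound
`χ` below (`exists_obliqueness_bound`). At a boundary minimum of `χ` the barrier gives `dχ = (K - μ)
dh` with `μ ≥ 0`. Evaluate this on `w = Rᵀν'`, which `F` sends to `b Rν`. As `R` is parallel, the
left side is `Hess h (w, w) + b Hess h' (Rν, Rν) ≥ θ`, while `dh(w) = χ`. Thus `θ ≤ K χ`. -/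

lemma pd_add {φ ψ : Plane → ℝ} {x : Plane} (i : Fin 2) (hφ : DifferentiableAt ℝ φ x)
    (hψ : DifferentiableAt ℝ ψ x) : pd i (fun y => φ y + ψ y) x = pd i φ x + pd i ψ x := by
  simp [pd, fderiv_fun_add hφ hψ]

lemma pd_mul {φ ψ : Plane → ℝ} {x : Plane} (i : Fin 2) (hφ : DifferentiableAt ℝ φ x)
    (hψ : DifferentiableAt ℝ ψ x) :
    pd i (fun y => φ y * ψ y) x = pd i φ x * ψ x + φ x * pd i ψ x := by
  simp [pd, fderiv_fun_mul hφ hψ]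
  ring

lemma pd_congr {φ ψ : Plane → ℝ} {x : Plane} (i : Fin 2) (h : φ =ᶠ[𝓝 x] ψ) :
    pd i φ x = pd i ψ x := by
  simp [pd, h.fderiv_eq]

lemma plane_eq_sum (v : Plane) :
    v = v 0 • (Pi.single 0 1 : Plane) + v 1 • (Pi.single 1 1 : Plane) := by
  ext i; fin_cases i <;> simp

lemma clm_apply_eq {F : Type*} [NormedAddCommGroup F] [NormedSpace ℝ F] (A : Plane →L[ℝ] F)
    (v : Plane) : A v = v 0 • A (Pi.single 0 1) + v 1 • A (Pi.single 1 1) := by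
  conv_lhs => rw [plane_eq_sum v]
  simp

lemma fderiv_apply_eq_pd (φ : Plane → ℝ) (x v : Plane) :
    fderiv ℝ φ x v = v 0 * pd 0 φ x + v 1 * pd 1 φ x :=
  clm_apply_eq _ _

lemma contDiffAt_pd {φ : Plane → ℝ} {x : Plane} (i : Fin 2) (h : ContDiffAt ℝ ∞ φ x) :
    ContDiffAt ℝ ∞ (pd i φ) x :=
  (h.fderiv_right (m := ∞) (by simp)).clm_apply contDiffAt_const

lemma contDiff_pd {φ : Plane → ℝ} (i : Fin 2) (h : ContDiff ℝ ∞ φ) : ContDiff ℝ ∞ (pd i φ) :=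
  contDiff_iff_contDiffAt.2 fun _ => contDiffAt_pd i h.contDiffAt

lemma fderiv_fderiv_apply {F : Type*} [NormedAddCommGroup F] [NormedSpace ℝ F] {φ : Plane → F}
    {x : Plane} (h : ContDiffAt ℝ ∞ φ x) (v w : Plane) :
    fderiv ℝ (fun y => fderiv ℝ φ y w) x v = fderiv ℝ (fderiv ℝ φ) x v w := by
  have h1 : DifferentiableAt ℝ (fderiv ℝ φ) x :=
    (h.fderiv_right (m := ∞) (by simp)).differentiableAt (by simp)
  rw [fderiv_clm_apply h1 (by fun_prop)]
  simp

lemma pd_pd_comm {φ : Plane → ℝ} {x : Plane} (h : ContDiffAt ℝ ∞ φ x) (i j : Fin 2) :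
    pd i (pd j φ) x = pd j (pd i φ) x := by
  have := h.isSymmSndFDerivAt (by simpa using WithTop.coe_le_coe.2 (le_top : (2 : ℕ∞) ≤ ⊤))
  change fderiv ℝ (fun y => fderiv ℝ φ y _) x _ = fderiv ℝ (fun y => fderiv ℝ φ y _) x _
  rw [fderiv_fderiv_apply h, fderiv_fderiv_apply h]
  exact this.eq _ _

lemma fderiv_fderiv_eq_pd {φ : Plane → ℝ} {x : Plane} (h : ContDiffAt ℝ ∞ φ x) (v w : Plane) :
    fderiv ℝ (fun y => fderiv ℝ φ y w) x v = ∑ i, ∑ j, pd i (pd j φ) x * v i * w j := by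
  have h2 : ∀ i j, pd i (pd j φ) x
      = fderiv ℝ (fderiv ℝ φ) x (Pi.single i 1) (Pi.single j 1) := fun i j =>
    fderiv_fderiv_apply h _ _
  rw [fderiv_fderiv_apply h, clm_apply_eq _ v]
  simp only [h2, Fin.sum_univ_two, _root_.add_apply, _root_.smul_apply]
  rw [clm_apply_eq _ w, clm_apply_eq (fderiv ℝ (fderiv ℝ φ) x (Pi.single 1 1)) w]
  simp only [smul_eq_mul]
  ring

lemma jac_apply {f : Plane → Plane} {x : Plane} (h : DifferentiableAt ℝ f x) (k i : Fin 2) :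
    jac f x k i = fderiv ℝ f x (Pi.single i 1) k := by
  have : ∀ k, DifferentiableAt ℝ (fun y => f y k) x := fun k => differentiableAt_pi.1 h k
  rw [jac, pd, fderiv_pi (φ := fun k y => f y k) this]
  rfl

lemma jac_mulVec {f : Plane → Plane} {x : Plane} (h : DifferentiableAt ℝ f x) (v : Plane) :
    jac f x *ᵥ v = fderiv ℝ f x v := by
  ext k
  rw [clm_apply_eq (fderiv ℝ f x) v]
  simp [Matrix.mulVec, dotProduct, jac_apply h, Fin.sum_univ_two]
  ring

lemma contDiffAt_jac {f : Plane → Plane} {x : Plane} (h : ContDiffAt ℝ ∞ f x) (k i : Fin 2) :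
    ContDiffAt ℝ ∞ (fun y => jac f y k i) x :=
  contDiffAt_pd i (contDiffAt_pi.1 h k)

lemma SmoothNear.contDiffAt {F : Type*} [NormedAddCommGroup F] [NormedSpace ℝ F]
    {φ : Plane → F} {Ω : Set Plane} (h : SmoothNear φ Ω) {x : Plane} (hx : x ∈ Ω) :
    ContDiffAt ℝ ∞ φ x := by
  obtain ⟨U, hU, hΩU, hφ⟩ := h
  exact hφ.contDiffAt (hU.mem_nhds (hΩU hx))

/-! ### The Hessian and the trace of second derivatives -/

/-- The second order operator `∑ₘ D²φ(eₘ, eₘ) - Dφ(b)` with coefficients frozen at a point. -/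
def lap {F : Type*} [NormedAddCommGroup F] [NormedSpace ℝ F] (e : Fin 2 → Plane) (b : Plane)
    (φ : Plane → F) (x : Plane) : F :=
  ∑ m, fderiv ℝ (fun y => fderiv ℝ φ y (e m)) x (e m) - fderiv ℝ φ x b

lemma Metric.hess_eq (g : Metric) {φ : Plane → ℝ} {x : Plane} (h : ContDiffAt ℝ ∞ φ x)
    (v w : Plane) :
    g.hess φ x v w = fderiv ℝ (fun y => fderiv ℝ φ y w) x v - fderiv ℝ φ x (g.gamma x v w) := by
  rw [fderiv_fderiv_eq_pd h, fderiv_apply_eq_pd, Metric.hess]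
  simp only [Metric.gamma, Fin.sum_univ_two]
  ring

/-- With this choice of `b` the Christoffel terms assemble into the Hessian, so `lap` becomes
coordinate-free and uniform convexity can be applied to it. -/
lemma lap_eq_hess (g : Metric) {φ : Plane → ℝ} {x : Plane} (h : ContDiffAt ℝ ∞ φ x)
    (e : Fin 2 → Plane) :
    lap e (∑ m, g.gamma x (e m) (e m)) φ x = ∑ m, g.hess φ x (e m) (e m) := by
  simp only [lap, g.hess_eq h, Fin.sum_univ_two, map_add]
  ring

lemma deriv_line {φ : Plane → ℝ} {x v : Plane} (h : ContDiffAt ℝ ∞ φ x) :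
    deriv (fun t : ℝ => φ (x + t • v)) =ᶠ[𝓝 0] fun t => fderiv ℝ φ (x + t • v) v := by
  have h1 : ∀ᶠ y in 𝓝 x, DifferentiableAt ℝ φ y := by
    filter_upwards [(h.of_le (m := 1) (by simp)).eventually (by simp)] with y hy
    exact hy.differentiableAt (by simp)
  have h2 : Tendsto (fun t : ℝ => x + t • v) (𝓝 0) (𝓝 x) := by
    have : Continuous (fun t : ℝ => x + t • v) := by fun_prop
    simpa using this.tendsto 0
  filter_upwards [h2.eventually h1] with t ht
  have h3 : HasDerivAt (fun t : ℝ => x + t • v) v t := by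
    simpa using ((hasDerivAt_id t).smul_const v).const_add x
  exact (ht.hasFDerivAt.comp_hasDerivAt t h3).deriv

/-- The second derivative is nonnegative at an interior minimum. -/
lemma IsLocalMin.second_deriv_nonneg {φ : Plane → ℝ} {x : Plane} (hmin : IsLocalMin φ x)
    (h : ContDiffAt ℝ ∞ φ x) (v : Plane) :
    0 ≤ fderiv ℝ (fun y => fderiv ℝ φ y v) x v := by
  by_contra! hneg
  have hc : Continuous (fun t : ℝ => x + t • v) := by fun_prop
  have hline : Tendsto (fun t : ℝ => x + t • v) (𝓝 0) (𝓝 x) := by simpa using hc.tendsto 0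
  set ψ : ℝ → ℝ := fun t => φ (x + t • v) with hψ
  have hmin' : IsLocalMin ψ 0 := by
    have := hline.eventually hmin
    simpa [IsLocalMin, IsMinFilter, hψ] using this
  have hd := deriv_line (v := v) h
  have hd0 : deriv ψ 0 = 0 := hmin'.deriv_eq_zero
  have h1 : ContDiffAt ℝ ∞ (fun y => fderiv ℝ φ y v) x :=
    (h.fderiv_right (m := ∞) (by simp)).clm_apply contDiffAt_const
  have h3 : HasDerivAt (fun t : ℝ => x + t • v) v 0 := by
    simpa using ((hasDerivAt_id (0 : ℝ)).smul_const v).const_add x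
  have hdd : deriv (deriv ψ) 0 = fderiv ℝ (fun y => fderiv ℝ φ y v) x v := by
    rw [hd.deriv_eq]
    have h1' : HasFDerivAt (fun y => fderiv ℝ φ y v) (fderiv ℝ (fun y => fderiv ℝ φ y v) x)
        (x + (0 : ℝ) • v) := by
      simpa using (h1.differentiableAt (by simp)).hasFDerivAt
    exact (h1'.comp_hasDerivAt (0 : ℝ) h3).deriv
  have hcont : ContinuousAt ψ 0 := by
    have hc0 : ContinuousAt φ (x + (0 : ℝ) • v) := by simpa using h.continuousAt
    exact ContinuousAt.comp (f := fun t : ℝ => x + t • v) hc0 hc.continuousAt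
  -- A negative second derivative would make `0` a local maximum of `ψ` as well as a local minimum.
  -- Then `ψ` is locally constant and its second derivative is zero.
  have hmax : IsLocalMax ψ 0 := isLocalMax_of_deriv_deriv_neg (by rw [hdd]; exact hneg) hd0 hcont
  have hconst : ψ =ᶠ[𝓝 0] fun _ => ψ 0 := by
    filter_upwards [hmin', hmax] with t h1 h2 using le_antisymm h2 h1
  have : deriv (deriv ψ) 0 = 0 := by
    rw [hconst.deriv.deriv_eq]
    simp
  linarith [hdd ▸ this]

/-- A minimum principle: if every interior point carries an operator `lap` that is negative on
`φ`, then `φ` is bounded below by its boundary values. -/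
lemma le_of_lap_neg {Ω : Set Plane} (hΩ : IsCompact Ω) {φ : Plane → ℝ}
    (hφ : ∀ x ∈ Ω, ContDiffAt ℝ ∞ φ x)
    (hlap : ∀ x ∈ interior Ω, ∃ e b, lap e b φ x < 0) {c : ℝ} (hc : ∀ x ∈ frontier Ω, c ≤ φ x)
    {x : Plane} (hx : x ∈ Ω) : c ≤ φ x := by
  obtain ⟨p, hp, hmin⟩ := hΩ.exists_isMinOn ⟨x, hx⟩
    (fun y hy => (hφ y hy).continuousAt.continuousWithinAt)
  refine le_trans ?_ (hmin hx)
  by_cases hpi : p ∈ interior Ω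
  · exfalso
    obtain ⟨e, b, hlt⟩ := hlap p hpi
    have hloc : IsLocalMin φ p := hmin.isLocalMin (mem_interior_iff_mem_nhds.1 hpi)
    have h0 : fderiv ℝ φ p = 0 := hloc.fderiv_eq_zero
    have h1 := IsLocalMin.second_deriv_nonneg hloc (hφ p hp) (e 0)
    have h2 := IsLocalMin.second_deriv_nonneg hloc (hφ p hp) (e 1)
    simp only [lap, h0, Fin.sum_univ_two, _root_.zero_apply] at hlt
    linarith
  · exact hc p ⟨subset_closure hp, hpi⟩

/-! ### Boundary points of smooth domains -/

lemma IsStrictlyConvexDomain.frontier_subset {g : Metric} {Ω : Set Plane}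
    (hΩ : IsStrictlyConvexDomain g Ω) : frontier Ω ⊆ Ω :=
  hΩ.compact.isClosed.frontier_subset

/-- At a boundary point, the inward directions are those on which a certain nonzero covector is
negative. -/
lemma IsStrictlyConvexDomain.exists_covector {g : Metric} {Ω : Set Plane}
    (hΩ : IsStrictlyConvexDomain g Ω) {p : Plane} (hp : p ∈ frontier Ω) :
    ∃ l : Plane →L[ℝ] ℝ, l ≠ 0 ∧
      ∀ v, l v < 0 → ∀ᶠ t : ℝ in 𝓝[>] 0, p + t • v ∈ interior Ω := by
  obtain ⟨U, ρ, hU, hpU, hρ, hΩU, hne, -⟩ := hΩ.boundary p hp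
  have hρp : ContDiffAt ℝ ∞ ρ p := hρ.contDiffAt (hU.mem_nhds hpU)
  have hsub : ∀ y ∈ U, ρ y < 0 → y ∈ interior Ω := by
    intro y hy hlt
    have hcont : ContinuousAt ρ y := (hρ.contDiffAt (hU.mem_nhds hy)).continuousAt
    rw [mem_interior_iff_mem_nhds]
    filter_upwards [hU.mem_nhds hy, hcont.eventually (gt_mem_nhds hlt)] with z hz hz'
    exact (hΩU.symm ▸ (⟨hz, hz'.le⟩ : z ∈ {x ∈ U | ρ x ≤ 0}) : z ∈ Ω ∩ U).1
  -- Where `ρ < 0` the point is interior, so a frontier point has `ρ = 0`.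
  have hp0 : ρ p = 0 := by
    have h1 : ρ p ≤ 0 :=
      (hΩU ▸ (⟨hΩ.frontier_subset hp, hpU⟩ : p ∈ Ω ∩ U) : p ∈ {x ∈ U | ρ x ≤ 0}).2
    refine h1.eq_of_not_lt fun hlt => hp.2 (hsub p hpU hlt)
  refine ⟨fderiv ℝ ρ p, hne, fun v hv => ?_⟩
  have hline : HasDerivAt (fun t : ℝ => p + t • v) v 0 := by
    simpa using ((hasDerivAt_id (0 : ℝ)).smul_const v).const_add p
  have hder : HasDerivAt (fun t : ℝ => ρ (p + t • v)) (fderiv ℝ ρ p v) 0 := by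
    have h1' : HasFDerivAt ρ (fderiv ℝ ρ p) (p + (0 : ℝ) • v) := by
      simpa using (hρp.differentiableAt (by simp)).hasFDerivAt
    exact h1'.comp_hasDerivAt (0 : ℝ) hline
  have hU' : ∀ᶠ t : ℝ in 𝓝 0, p + t • v ∈ U := by
    have : Tendsto (fun t : ℝ => p + t • v) (𝓝 0) (𝓝 p) := by
      simpa using hline.continuousAt.tendsto
    exact this.eventually (hU.mem_nhds hpU)
  have hslope := (hasDerivAt_iff_tendsto_slope.1 hder).eventually (gt_mem_nhds hv)
  have hslope' : ∀ᶠ t : ℝ in 𝓝[>] 0, slope (fun t : ℝ => ρ (p + t • v)) 0 t < 0 :=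
    hslope.filter_mono (nhdsWithin_mono _ fun t ht => ne_of_gt ht)
  filter_upwards [hslope', hU'.filter_mono nhdsWithin_le_nhds, self_mem_nhdsWithin]
    with t ht htU htpos
  refine hsub _ htU ?_
  have htpos' : (0 : ℝ) < t := htpos
  simp only [slope_def_field, zero_smul, add_zero, hp0, sub_zero] at ht
  by_contra! hge
  exact absurd ht (not_lt.2 (div_nonneg hge htpos'.le))

lemma exists_neg_of_ne_zero {l : Plane →L[ℝ] ℝ} (h : l ≠ 0) : ∃ v, l v < 0 := by
  by_contra! hcon
  refine h (ContinuousLinearMap.ext fun v => le_antisymm ?_ (hcon v))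
  have := hcon (-v)
  simp only [map_neg] at this
  simpa using this

/-- A boundary point is the limit of the interior points on a short inward segment. -/
lemma IsStrictlyConvexDomain.subset_closure_interior {g : Metric} {Ω : Set Plane}
    (hΩ : IsStrictlyConvexDomain g Ω) : Ω ⊆ closure (interior Ω) := by
  intro p hp
  by_cases hpi : p ∈ interior Ω
  · exact subset_closure hpi
  · obtain ⟨l, hl, hin⟩ := hΩ.exists_covector ⟨subset_closure hp, hpi⟩
    obtain ⟨v, hv⟩ := exists_neg_of_ne_zero hl
    have hc : Continuous (fun t : ℝ => p + t • v) := by fun_prop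
    have ht : Tendsto (fun t : ℝ => p + t • v) (𝓝[>] 0) (𝓝 p) := by
      simpa using (hc.tendsto 0).mono_left nhdsWithin_le_nhds
    exact mem_closure_of_tendsto ht (hin v hv)

/-- Carries to the boundary, by continuity, the identities that can only be derived on an open set:
the unit Jacobian and the equation for the rotation. -/
lemma IsStrictlyConvexDomain.eq_of_eqOn_interior {g : Metric} {Ω : Set Plane}
    (hΩ : IsStrictlyConvexDomain g Ω) {F : Type*} [TopologicalSpace F] [T2Space F]
    {φ ψ : Plane → F} {p : Plane} (hp : p ∈ Ω) (hφ : ContinuousAt φ p) (hψ : ContinuousAt ψ p)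
    (h : ∀ x ∈ interior Ω, φ x = ψ x) : φ p = ψ p := by
  have : (𝓝[interior Ω] p).NeBot := mem_closure_iff_nhdsWithin_neBot.1
    (hΩ.subset_closure_interior hp)
  refine tendsto_nhds_unique (l := 𝓝[interior Ω] p) (hφ.tendsto.mono_left nhdsWithin_le_nhds)
    ((hψ.tendsto.mono_left nhdsWithin_le_nhds).congr' ?_)
  filter_upwards [self_mem_nhdsWithin] with x hx using (h x hx).symm

/-- Two covectors are proportional if one is nonnegative wherever the other is negative. -/
lemma exists_eq_neg_smul {l m : Plane →L[ℝ] ℝ} (hl : l ≠ 0) (h : ∀ v, l v < 0 → 0 ≤ m v) :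
    ∃ μ : ℝ, 0 ≤ μ ∧ m = -μ • l := by
  obtain ⟨v₀, hv₀⟩ := exists_neg_of_ne_zero hl
  have hle : ∀ v, l v ≤ 0 → 0 ≤ m v := by
    intro v hv
    by_contra! hneg
    -- Push `v` slightly towards `v₀`, into the open half-plane, while keeping `m` negative. The `+
    -- 1` protects against `m v₀ = 0`.
    have hε : ∃ ε > 0, m v + ε * m v₀ < 0 := by
      have hm := h v₀ hv₀
      refine ⟨-m v / (2 * (m v₀ + 1)), by apply div_pos <;> linarith, ?_⟩
      have : -m v / (2 * (m v₀ + 1)) * m v₀ ≤ -m v / 2 := by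
        rw [div_mul_eq_mul_div, div_le_div_iff₀ (by linarith) (by norm_num)]
        nlinarith
      linarith
    obtain ⟨ε, hε, hlt⟩ := hε
    have := h (v + ε • v₀) (by simp; nlinarith)
    simp at this
    linarith
  refine ⟨-(m v₀ / l v₀), ?_, ?_⟩
  · rw [neg_nonneg]
    exact div_nonpos_of_nonneg_of_nonpos (h v₀ hv₀) hv₀.le
  · ext v
    -- The component of `v` along `ker l`, and its negative, both satisfy `l ≤ 0`, so `m` vanishes
    -- on it.
    have h1 := hle (v - (l v / l v₀) • v₀) (by simp [hv₀.ne])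
    have h2 := hle (-(v - (l v / l v₀) • v₀)) (by simp [hv₀.ne])
    simp only [map_neg, map_sub, map_smul, smul_eq_mul] at h1 h2
    simp only [neg_neg, _root_.smul_apply, smul_eq_mul]
    have : l v / l v₀ * m v₀ = m v₀ / l v₀ * l v := by ring
    linarith

lemma fderiv_nonneg_of_inward {Ω : Set Plane}
    {φ : Plane → ℝ} {p v : Plane}
    (hφ : DifferentiableAt ℝ φ p) (hmin : ∀ x ∈ Ω, φ p ≤ φ x)
    (hv : ∀ᶠ t : ℝ in 𝓝[>] 0, p + t • v ∈ interior Ω) : 0 ≤ fderiv ℝ φ p v := by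
  have hline : HasDerivAt (fun t : ℝ => p + t • v) v 0 := by
    simpa using ((hasDerivAt_id (0 : ℝ)).smul_const v).const_add p
  have hder : HasDerivAt (fun t : ℝ => φ (p + t • v)) (fderiv ℝ φ p v) 0 := by
    have h1' : HasFDerivAt φ (fderiv ℝ φ p) (p + (0 : ℝ) • v) := by
      simpa using hφ.hasFDerivAt
    exact h1'.comp_hasDerivAt (0 : ℝ) hline
  have hslope := (hasDerivAt_iff_tendsto_slope.1 hder).mono_left
    (nhdsWithin_mono (0 : ℝ) (fun t (ht : t ∈ Set.Ioi 0) => ne_of_gt ht))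
  refine ge_of_tendsto hslope ?_
  filter_upwards [hv, self_mem_nhdsWithin] with t ht htpos
  have htpos' : (0 : ℝ) < t := htpos
  simp only [slope_def_field, zero_smul, add_zero, sub_zero]
  exact div_nonneg (sub_nonneg.2 (hmin _ (interior_subset ht))) htpos'.le

/-- A function attaining its minimum over `Ω` at a boundary point has an inward pointing
differential there, measured against a function that is maximal along the boundary. -/
lemma IsStrictlyConvexDomain.exists_fderiv_eq {g : Metric} {Ω : Set Plane}
    (hΩ : IsStrictlyConvexDomain g Ω) {h φ : Plane → ℝ} {p : Plane} (hp : p ∈ frontier Ω)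
    (hh : DifferentiableAt ℝ h p) (hne : fderiv ℝ h p ≠ 0) (hmax : ∀ x ∈ Ω, h x ≤ h p)
    (hφ : DifferentiableAt ℝ φ p) (hmin : ∀ x ∈ Ω, φ p ≤ φ x) :
    ∃ μ : ℝ, 0 ≤ μ ∧ fderiv ℝ φ p = -μ • fderiv ℝ h p := by
  obtain ⟨l, hl, hin⟩ := hΩ.exists_covector hp
  obtain ⟨μ, hμ, hφl⟩ := exists_eq_neg_smul hl
    (fun v hv => fderiv_nonneg_of_inward hφ hmin (hin v hv))
  -- The same argument for `-h`, which is minimal at `p`, makes `dh` a multiple of the same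
  -- covector; the factor is positive because `dh ≠ 0`.
  obtain ⟨μ', hμ', hhl⟩ := exists_eq_neg_smul (m := fderiv ℝ (fun x => -h x) p) hl
    (fun v hv => fderiv_nonneg_of_inward hh.fun_neg
      (fun x hx => neg_le_neg (hmax x hx)) (hin v hv))
  replace hhl : fderiv ℝ h p = μ' • l := by
    rw [fderiv_fun_neg] at hhl
    rw [← neg_neg (fderiv ℝ h p), hhl]
    module
  have hμ'0 : 0 < μ' := by
    refine hμ'.lt_of_ne fun h0 => hne ?_
    rw [hhl, ← h0, zero_smul]
  refine ⟨μ / μ', by positivity, ?_⟩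
  rw [hφl, hhl, smul_smul]
  congr 1
  field_simp

/-! ### Diffeomorphisms and the boundary -/

lemma linearMap_range_eq_top {A B : Plane →L[ℝ] Plane} (h : A ∘L B = .id ℝ Plane) :
    B.range = ⊤ := by
  have hinj : Function.Injective (B : Plane →ₗ[ℝ] Plane) := by
    intro v w hvw
    have := congrArg A (show B v = B w from hvw)
    simpa [← ContinuousLinearMap.comp_apply, h] using this
  exact LinearMap.range_eq_top.2 (LinearMap.injective_iff_surjective.1 hinj)

/-- A diffeomorphism between closed sets maps boundary points to boundary points. -/
lemma IsDiffeo.mem_frontier {f : Plane → Plane} {Ω Ω' : Set Plane} (hf : IsDiffeo f Ω Ω')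
    {p : Plane} (hpΩ : p ∈ Ω) (hp : p ∈ frontier Ω) : f p ∈ frontier Ω' := by
  obtain ⟨hfs, f', hf's, hmaps, hmaps', hinv⟩ := hf
  refine ⟨subset_closure (hmaps hpΩ), fun hmem => hp.2 ?_⟩
  have hpf : f' (f p) = p := hinv.1 hpΩ
  have hd : HasFDerivAt f (fderiv ℝ f p) (f' (f p)) := by
    rw [hpf]
    exact ((hfs.contDiffAt hpΩ).differentiableAt (by simp)).hasFDerivAt
  have hc' := hf's.contDiffAt (hmaps hpΩ)
  have hd' := (hc'.differentiableAt (by simp)).hasFDerivAt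
  have hcomp := hd.comp (f p) hd'
  -- If `f p` were interior to `Ω'`, then `f ∘ f' = id` near it, so `Df'` is injective and hence
  -- onto. By the open mapping property `f'` then sends a neighbourhood of `f p`, taken inside `Ω'`,
  -- to a neighbourhood of `p` inside `Ω`.
  have hid : f ∘ f' =ᶠ[𝓝 (f p)] id := by
    filter_upwards [mem_interior_iff_mem_nhds.1 hmem] with y hy using hinv.2 hy
  have heq : fderiv ℝ f p ∘L fderiv ℝ f' (f p) = .id ℝ Plane :=
    hcomp.unique ((hasFDerivAt_id (f p)).congr_of_eventuallyEq hid)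
  have hmap := (hc'.hasStrictFDerivAt (by simp)).map_nhds_eq_of_surj (linearMap_range_eq_top heq)
  rw [hpf] at hmap
  rw [mem_interior_iff_mem_nhds, ← hmap]
  exact Filter.mem_map.2 (Filter.mem_of_superset (mem_interior_iff_mem_nhds.1 hmem) hmaps')

/-! ### Orthonormal frames -/

/-- The rotation by a right angle. -/
def rotJ : Matrix (Fin 2) (Fin 2) ℝ := !![0, -1; 1, 0]

/-- The upper triangular Cholesky factor of a positive definite matrix. -/
def cholesky (M : Matrix (Fin 2) (Fin 2) ℝ) : Matrix (Fin 2) (Fin 2) ℝ :=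
  !![√(M 0 0), M 0 1 / √(M 0 0); 0, √(M.det / M 0 0)]

lemma posDef_apply_comm {M : Matrix (Fin 2) (Fin 2) ℝ} (h : M.PosDef) (i j : Fin 2) :
    M i j = M j i := by
  have := congrFun (congrFun h.isHermitian i) j
  simpa using this.symm

lemma cholesky_transpose_mul {M : Matrix (Fin 2) (Fin 2) ℝ} (h : M.PosDef) :
    (cholesky M)ᵀ * cholesky M = M := by
  have h0 : 0 < M 0 0 := h.diag_pos
  have hd : 0 < M.det := h.det_pos
  have h1 : √(M 0 0) * √(M 0 0) = M 0 0 := Real.mul_self_sqrt h0.le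
  have h2 : √(M.det / M 0 0) * √(M.det / M 0 0) = M.det / M 0 0 :=
    Real.mul_self_sqrt (by positivity)
  have h3 : √(M 0 0) ≠ 0 := (Real.sqrt_pos.2 h0).ne'
  have hs := posDef_apply_comm h 1 0
  ext i j
  fin_cases i <;> fin_cases j <;>
    simp only [cholesky, Matrix.mul_apply, Matrix.transpose_apply, Fin.sum_univ_two] <;> simp
  · exact h1
  · field_simp
  · rw [hs]; field_simp
  · rw [h2, div_mul_div_comm, h1, ← add_div, Matrix.det_fin_two, hs]
    field_simp
    ring

lemma cholesky_det_pos {M : Matrix (Fin 2) (Fin 2) ℝ} (h : M.PosDef) : 0 < (cholesky M).det := by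
  have h0 : 0 < M 0 0 := h.diag_pos
  have hd : 0 < M.det := h.det_pos
  simp only [cholesky, Matrix.det_fin_two_of]
  have := mul_pos (Real.sqrt_pos.2 h0) (Real.sqrt_pos.2 (div_pos hd h0))
  linarith

/-- The matrix of an orthonormal coframe. -/
def Metric.coframe (g : Metric) (x : Plane) : Matrix (Fin 2) (Fin 2) ℝ := cholesky (g.coeff x)

/-- The matrix whose columns are the dual orthonormal frame. -/
def Metric.frame (g : Metric) (x : Plane) : Matrix (Fin 2) (Fin 2) ℝ := (g.coframe x)⁻¹

lemma Metric.coeff_comm (g : Metric) (x : Plane) (i j : Fin 2) :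
    g.coeff x i j = g.coeff x j i :=
  posDef_apply_comm (g.posDef x) i j

lemma Metric.coframe_transpose_mul (g : Metric) (x : Plane) :
    (g.coframe x)ᵀ * g.coframe x = g.coeff x :=
  cholesky_transpose_mul (g.posDef x)

lemma Metric.coframe_det_pos (g : Metric) (x : Plane) : 0 < (g.coframe x).det :=
  cholesky_det_pos (g.posDef x)

lemma Metric.isUnit_coframe (g : Metric) (x : Plane) : IsUnit (g.coframe x).det :=
  (g.coframe_det_pos x).ne'.isUnit

lemma Metric.coframe_mul_frame (g : Metric) (x : Plane) : g.coframe x * g.frame x = 1 :=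
  Matrix.mul_nonsing_inv _ (g.isUnit_coframe x)

lemma Metric.frame_mul_coframe (g : Metric) (x : Plane) : g.frame x * g.coframe x = 1 :=
  Matrix.nonsing_inv_mul _ (g.isUnit_coframe x)

lemma Metric.det_coeff (g : Metric) (x : Plane) :
    (g.coeff x).det = (g.coframe x).det ^ 2 := by
  rw [← g.coframe_transpose_mul, Matrix.det_mul, Matrix.det_transpose, sq]

lemma Metric.sqrt_det_coeff (g : Metric) (x : Plane) :
    √(g.coeff x).det = (g.coframe x).det := by
  rw [g.det_coeff, Real.sqrt_sq (g.coframe_det_pos x).le]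

lemma Metric.contDiff_det (g : Metric) : ContDiff ℝ ∞ (fun x => (g.coeff x).det) := by
  simp only [Matrix.det_fin_two]
  exact ((g.smooth 0 0).mul (g.smooth 1 1)).sub ((g.smooth 0 1).mul (g.smooth 1 0))

lemma Metric.contDiff_coframe (g : Metric) (a b : Fin 2) :
    ContDiff ℝ ∞ (fun x => g.coframe x a b) := by
  have h0 : ∀ x, 0 < g.coeff x 0 0 := fun x => (g.posDef x).diag_pos
  have hd : ∀ x, 0 < (g.coeff x).det := fun x => (g.posDef x).det_pos
  have h1 : ContDiff ℝ ∞ (fun x => √(g.coeff x 0 0)) :=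
    (g.smooth 0 0).sqrt fun x => (h0 x).ne'
  fin_cases a <;> fin_cases b <;> simp only [Metric.coframe, cholesky] <;> simp
  · exact h1
  · exact (g.smooth 0 1).div h1 fun x => (Real.sqrt_pos.2 (h0 x)).ne'
  · exact contDiff_const
  · exact (g.contDiff_det.div (g.smooth 0 0) fun x => (h0 x).ne').sqrt
      fun x => (div_pos (hd x) (h0 x)).ne'

lemma inv_apply_fin_two (M : Matrix (Fin 2) (Fin 2) ℝ) (a b : Fin 2) :
    M⁻¹ a b = M.adjugate a b / M.det := by
  simp [Matrix.inv_def, Ring.inverse_eq_inv', div_eq_inv_mul]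

lemma contDiff_inv_apply {M : Plane → Matrix (Fin 2) (Fin 2) ℝ}
    (h : ∀ a b, ContDiff ℝ ∞ (fun x => M x a b)) (hd : ∀ x, (M x).det ≠ 0) (a b : Fin 2) :
    ContDiff ℝ ∞ (fun x => (M x)⁻¹ a b) := by
  have hdet : ContDiff ℝ ∞ (fun x => (M x).det) := by
    simp only [Matrix.det_fin_two]
    exact ((h 0 0).mul (h 1 1)).sub ((h 0 1).mul (h 1 0))
  simp only [inv_apply_fin_two]
  refine ContDiff.div ?_ hdet hd
  fin_cases a <;> fin_cases b <;> simp [Matrix.adjugate_fin_two]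
  · exact h 1 1
  · exact (h 0 1).neg
  · exact (h 1 0).neg
  · exact h 0 0

lemma Metric.contDiff_frame (g : Metric) (a b : Fin 2) :
    ContDiff ℝ ∞ (fun x => g.frame x a b) :=
  contDiff_inv_apply g.contDiff_coframe (fun x => (g.coframe_det_pos x).ne') a b

lemma Metric.contDiff_christoffel (g : Metric) (k i j : Fin 2) :
    ContDiff ℝ ∞ (g.christoffel k i j) := by
  unfold Metric.christoffel
  refine contDiff_const.mul (ContDiff.sum fun l _ => ContDiff.mul ?_ ?_)
  · exact contDiff_inv_apply g.smooth (fun x => (g.posDef x).det_pos.ne') k l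
  · exact ((contDiff_pd i (g.smooth j l)).add (contDiff_pd j (g.smooth i l))).sub
      (contDiff_pd l (g.smooth i j))

/-! ### The Levi-Civita connection -/

lemma Metric.christoffel_comm (g : Metric) (k i j : Fin 2) (x : Plane) :
    g.christoffel k i j x = g.christoffel k j i x := by
  simp only [Metric.christoffel, g.coeff_comm _ i j]
  congr 1
  refine Finset.sum_congr rfl fun l _ => ?_
  ring

lemma Metric.sum_coeff_christoffel (g : Metric) (m i j : Fin 2) (x : Plane) :
    ∑ k, g.coeff x m k * g.christoffel k i j x = (1 / 2) * (pd i (fun y => g.coeff y j m) x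
      + pd j (fun y => g.coeff y i m) x - pd m (fun y => g.coeff y i j) x) := by
  have hinv : g.coeff x * (g.coeff x)⁻¹ = 1 :=
    Matrix.mul_nonsing_inv _ (g.posDef x).det_pos.ne'.isUnit
  have h := fun l => congrFun (congrFun hinv m) l
  simp only [Matrix.mul_apply, Fin.sum_univ_two] at h
  have h0 := h 0
  have h1 := h 1
  simp only [Metric.christoffel, Fin.sum_univ_two]
  obtain rfl | rfl : m = 0 ∨ m = 1 := by omega
  all_goals simp at h0 h1
  · linear_combination (1 / 2) * (pd i (fun y => g.coeff y j 0) x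
      + pd j (fun y => g.coeff y i 0) x - pd 0 (fun y => g.coeff y i j) x) * h0
      + (1 / 2) * (pd i (fun y => g.coeff y j 1) x
      + pd j (fun y => g.coeff y i 1) x - pd 1 (fun y => g.coeff y i j) x) * h1
  · linear_combination (1 / 2) * (pd i (fun y => g.coeff y j 0) x
      + pd j (fun y => g.coeff y i 0) x - pd 0 (fun y => g.coeff y i j) x) * h0
      + (1 / 2) * (pd i (fun y => g.coeff y j 1) x
      + pd j (fun y => g.coeff y i 1) x - pd 1 (fun y => g.coeff y i j) x) * h1

/-- The matrix `(Γ^k_{ij})_{k, j}` of the connection in the direction `∂ᵢ`. -/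
def Metric.gammaMatrix (g : Metric) (i : Fin 2) (x : Plane) : Matrix (Fin 2) (Fin 2) ℝ :=
  .of fun k j => g.christoffel k i j x

/-- The entrywise partial derivative of a matrix valued function. -/
def pdMatrix (i : Fin 2) (M : Plane → Matrix (Fin 2) (Fin 2) ℝ) (x : Plane) :
    Matrix (Fin 2) (Fin 2) ℝ :=
  .of fun a b => pd i (fun y => M y a b) x

lemma pdMatrix_mul {M N : Plane → Matrix (Fin 2) (Fin 2) ℝ} {x : Plane} (i : Fin 2)
    (hM : ∀ a b, DifferentiableAt ℝ (fun y => M y a b) x)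
    (hN : ∀ a b, DifferentiableAt ℝ (fun y => N y a b) x) :
    pdMatrix i (fun y => M y * N y) x = pdMatrix i M x * N x + M x * pdMatrix i N x := by
  ext a b
  simp only [pdMatrix, Matrix.of_apply, Matrix.add_apply, Matrix.mul_apply, Fin.sum_univ_two]
  rw [pd_add i ((hM a 0).fun_mul (hN 0 b)) ((hM a 1).fun_mul (hN 1 b)),
    pd_mul i (hM a 0) (hN 0 b), pd_mul i (hM a 1) (hN 1 b)]
  ring

/-- The Levi-Civita connection is compatible with the metric. -/
lemma Metric.pdMatrix_coeff (g : Metric) (i : Fin 2) (x : Plane) :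
    pdMatrix i g.coeff x
      = g.coeff x * g.gammaMatrix i x + (g.gammaMatrix i x)ᵀ * g.coeff x := by
  ext a b
  have h1 := g.sum_coeff_christoffel a i b x
  have h2 := g.sum_coeff_christoffel b i a x
  simp only [Fin.sum_univ_two, g.coeff_comm _ b] at h1 h2
  simp only [pdMatrix, Metric.gammaMatrix, Matrix.of_apply, Matrix.add_apply, Matrix.mul_apply,
    Matrix.transpose_apply, Fin.sum_univ_two]
  simp only [g.coeff_comm _ 0 b, g.coeff_comm _ 1 b] at h1 h2 ⊢
  have h3 : (fun y => g.coeff y b a) = fun y => g.coeff y a b :=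
    funext fun y => g.coeff_comm y b a
  simp only [g.coeff_comm _ b] at *
  linarith

/-- The matrix of the connection in the orthonormal frame. -/
def Metric.connMatrix (g : Metric) (i : Fin 2) (x : Plane) : Matrix (Fin 2) (Fin 2) ℝ :=
  (g.coframe x * g.gammaMatrix i x - pdMatrix i g.coframe x) * g.frame x

/-- Insert `g = SᵀS`, with `S` the coframe, into metric compatibility `∂g = gΓ + Γᵀg` and conjugate
by the frame `S⁻¹`. -/
lemma Metric.connMatrix_antisymm (g : Metric) (i : Fin 2) (x : Plane) :
    (g.connMatrix i x)ᵀ = -g.connMatrix i x := by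
  have hdiff : ∀ a b, DifferentiableAt ℝ (fun y => g.coframe y a b) x := fun a b =>
    (g.contDiff_coframe a b).contDiffAt.differentiableAt (by simp)
  have h1 : pdMatrix i g.coeff x = (pdMatrix i g.coframe x)ᵀ * g.coframe x
      + (g.coframe x)ᵀ * pdMatrix i g.coframe x := by
    have := pdMatrix_mul (M := fun y => (g.coframe y)ᵀ) (N := g.coframe) i
      (fun a b => hdiff b a) hdiff
    simp only [g.coframe_transpose_mul] at this
    exact this
  rw [g.pdMatrix_coeff, ← g.coframe_transpose_mul] at h1
  have hSE := g.coframe_mul_frame x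
  have hES : (g.frame x)ᵀ * (g.coframe x)ᵀ = 1 := by
    rw [← Matrix.transpose_mul, hSE, Matrix.transpose_one]
  have h2 := congrArg (fun M => (g.frame x)ᵀ * M * g.frame x) h1
  simp only [Metric.connMatrix, Matrix.transpose_mul, Matrix.transpose_sub]
  generalize g.frame x = E at *
  generalize g.coframe x = S at *
  generalize g.gammaMatrix i x = Γ at *
  generalize pdMatrix i g.coframe x = D at *
  have e1 : Eᵀ * (Sᵀ * S * Γ + Γᵀ * (Sᵀ * S)) * E = S * Γ * E + Eᵀ * (Γᵀ * Sᵀ) := by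
    calc _ = (Eᵀ * Sᵀ) * (S * Γ * E) + Eᵀ * (Γᵀ * Sᵀ) * (S * E) := by noncomm_ring
      _ = _ := by rw [hES, hSE]; simp
  have e2 : Eᵀ * (Dᵀ * S + Sᵀ * D) * E = Eᵀ * Dᵀ + D * E := by
    calc _ = Eᵀ * Dᵀ * (S * E) + (Eᵀ * Sᵀ) * (D * E) := by noncomm_ring
      _ = _ := by rw [hES, hSE]; simp
  rw [e1, e2] at h2
  rw [Matrix.mul_sub, Matrix.sub_mul, neg_sub, sub_eq_sub_iff_add_eq_add]
  rw [add_comm, h2, add_comm]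

/-- The connection form `α`, with `∇E₁ = α E₂` and `∇E₂ = -α E₁`, in the direction `∂ᵢ`. -/
def Metric.conn (g : Metric) (i : Fin 2) (x : Plane) : ℝ := g.connMatrix i x 1 0

lemma Metric.connMatrix_eq (g : Metric) (i : Fin 2) (x : Plane) :
    g.connMatrix i x = g.conn i x • rotJ := by
  have h := g.connMatrix_antisymm i x
  have h' := fun a b => congrFun (congrFun h a) b
  simp only [Matrix.transpose_apply, Matrix.neg_apply] at h'
  have h00 := h' 0 0
  have h11 := h' 1 1
  have h01 := h' 1 0
  ext a b
  fin_cases a <;> fin_cases b <;> simp [rotJ, Metric.conn] <;> linarith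

/-- The structure equation of the coframe. Every later derivative in orthonormal components reduces
to it, so the Christoffel symbols enter only through covariant derivatives and the scalars `conn`.
-/
lemma Metric.pdMatrix_coframe (g : Metric) (i : Fin 2) (x : Plane) :
    pdMatrix i g.coframe x
      = g.coframe x * g.gammaMatrix i x - g.conn i x • (rotJ * g.coframe x) := by
  have h := congrArg (· * g.coframe x) (g.connMatrix_eq i x)
  simp only [Metric.connMatrix] at h
  rw [Matrix.mul_assoc, g.frame_mul_coframe, Matrix.mul_one, Matrix.smul_mul] at h
  rw [← h]
  abel

lemma Metric.contDiff_conn (g : Metric) (i : Fin 2) : ContDiff ℝ ∞ (g.conn i) := by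
  unfold Metric.conn Metric.connMatrix
  simp only [Matrix.mul_apply, Matrix.sub_apply, Metric.gammaMatrix, pdMatrix, Matrix.of_apply]
  refine ContDiff.sum fun j _ => ContDiff.mul (ContDiff.sub (ContDiff.sum fun k _ => ?_) ?_)
    (g.contDiff_frame j 0)
  · exact (g.contDiff_coframe 1 k).mul (g.contDiff_christoffel k i j)
  · exact contDiff_pd i (g.contDiff_coframe 1 j)

/-- The connection form of the orthonormal frame. -/
def Metric.connForm (g : Metric) (x : Plane) : Plane →L[ℝ] ℝ :=
  g.conn 0 x • ContinuousLinearMap.proj 0 + g.conn 1 x • ContinuousLinearMap.proj 1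

lemma Metric.connForm_apply (g : Metric) (x v : Plane) :
    g.connForm x v = g.conn 0 x * v 0 + g.conn 1 x * v 1 := by
  simp [Metric.connForm]

lemma Metric.contDiff_connForm (g : Metric) : ContDiff ℝ ∞ g.connForm :=
  ((g.contDiff_conn 0).smul contDiff_const).add ((g.contDiff_conn 1).smul contDiff_const)

/-! ### Components of the differential in the frame -/

lemma Metric.inner_eq (g : Metric) (x v w : Plane) :
    g.inner x v w = (g.coframe x *ᵥ v) ⬝ᵥ (g.coframe x *ᵥ w) := by
  rw [Metric.inner, ← g.coframe_transpose_mul, ← Matrix.mulVec_mulVec, Matrix.dotProduct_mulVec,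
    Matrix.vecMul_transpose]

/-- The components of `dh` in the orthonormal frame. -/
def Metric.comp (g : Metric) (h : Plane → ℝ) (b : Fin 2) (x : Plane) : ℝ :=
  fderiv ℝ h x (fun k => g.frame x k b)

lemma Metric.contDiffAt_comp (g : Metric) {h : Plane → ℝ} {x : Plane} (b : Fin 2)
    (hh : ContDiffAt ℝ ∞ h x) : ContDiffAt ℝ ∞ (g.comp h b) x :=
  (hh.fderiv_right (m := ∞) (by simp)).clm_apply
    (contDiffAt_pi.2 fun k => (g.contDiff_frame k b).contDiffAt)

lemma Metric.sum_frame_coframe (g : Metric) (x v : Plane) :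
    v = (g.coframe x *ᵥ v) 0 • (fun k => g.frame x k 0)
      + (g.coframe x *ᵥ v) 1 • (fun k => g.frame x k 1) := by
  have h : g.frame x *ᵥ (g.coframe x *ᵥ v) = v := by
    rw [Matrix.mulVec_mulVec, g.frame_mul_coframe, Matrix.one_mulVec]
  ext k
  conv_lhs => rw [← h]
  rw [Matrix.mulVec]
  simp only [dotProduct, Fin.sum_univ_two, Pi.add_apply, Pi.smul_apply, smul_eq_mul]
  ring

lemma Metric.fderiv_eq_comp (g : Metric) (h : Plane → ℝ) (x v : Plane) :
    fderiv ℝ h x v = g.comp h 0 x * (g.coframe x *ᵥ v) 0 + g.comp h 1 x * (g.coframe x *ᵥ v) 1 := by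
  conv_lhs => rw [g.sum_frame_coframe x v]
  simp only [map_add, map_smul, Metric.comp, smul_eq_mul]
  ring

lemma Metric.hess_add_smul (g : Metric) (h : Plane → ℝ) (x v w w' : Plane) (a b : ℝ) :
    g.hess h x v (a • w + b • w') = a * g.hess h x v w + b * g.hess h x v w' := by
  simp only [Metric.hess, Fin.sum_univ_two, Pi.add_apply, Pi.smul_apply, smul_eq_mul]
  ring

lemma Metric.hess_smul_left (g : Metric) (h : Plane → ℝ) (x v w : Plane) (a : ℝ) :
    g.hess h x (a • v) w = a * g.hess h x v w := by
  simp only [Metric.hess, Fin.sum_univ_two, Pi.smul_apply, smul_eq_mul]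
  ring

/-- Differentiate `∂ₖh = ∑ (comp h b) S_{bk}` with the structure equation of the coframe `S`: the
Christoffel terms turn `∂²h` into the Hessian, and the connection form rotates the pair of
components. -/
lemma Metric.pd_comp (g : Metric) {h : Plane → ℝ} {x : Plane} (hh : ContDiffAt ℝ ∞ h x)
    (i : Fin 2) :
    pd i (g.comp h 0) x = g.hess h x (Pi.single i 1) (fun k => g.frame x k 0)
        + g.conn i x * g.comp h 1 x ∧
    pd i (g.comp h 1) x = g.hess h x (Pi.single i 1) (fun k => g.frame x k 1)
        - g.conn i x * g.comp h 0 x := by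
  have hS : ∀ a b, DifferentiableAt ℝ (fun y => g.coframe y a b) x := fun a b =>
    (g.contDiff_coframe a b).contDiffAt.differentiableAt (by simp)
  have hc : ∀ b, DifferentiableAt ℝ (g.comp h b) x := fun b =>
    (g.contDiffAt_comp b hh).differentiableAt (by simp)
  have hpd : ∀ k, pd k h = fun y =>
      g.comp h 0 y * g.coframe y 0 k + g.comp h 1 y * g.coframe y 1 k := by
    intro k
    funext y
    rw [pd, g.fderiv_eq_comp]
    simp
  have hcof := fun a k => congrFun (congrFun (g.pdMatrix_coframe i x) a) k
  simp only [pdMatrix, Matrix.of_apply, Matrix.sub_apply, Matrix.smul_apply, Matrix.mul_apply,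
    Fin.sum_univ_two, Metric.gammaMatrix, smul_eq_mul] at hcof
  have key : ∀ k, pd i (pd k h) x = pd i (g.comp h 0) x * g.coframe x 0 k
      + g.comp h 0 x * pd i (fun y => g.coframe y 0 k) x
      + (pd i (g.comp h 1) x * g.coframe x 1 k
      + g.comp h 1 x * pd i (fun y => g.coframe y 1 k) x) := by
    intro k
    rw [hpd k, pd_add i ((hc 0).fun_mul (hS 0 k)) ((hc 1).fun_mul (hS 1 k)),
      pd_mul i (hc 0) (hS 0 k), pd_mul i (hc 1) (hS 1 k)]
  have hk : ∀ k, pd k h x = g.comp h 0 x * g.coframe x 0 k + g.comp h 1 x * g.coframe x 1 k :=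
    fun k => congrFun (hpd k) x
  have hhess : ∀ w : Plane, g.hess h x (Pi.single i 1) w
      = (pd i (g.comp h 0) x - g.conn i x * g.comp h 1 x) * (g.coframe x *ᵥ w) 0
      + (pd i (g.comp h 1) x + g.conn i x * g.comp h 0 x) * (g.coframe x *ᵥ w) 1 := by
    intro w
    have hj : ∀ j, pd i (pd j h) x - ∑ k, g.christoffel k i j x * pd k h x
        = (pd i (g.comp h 0) x - g.conn i x * g.comp h 1 x) * g.coframe x 0 j
          + (pd i (g.comp h 1) x + g.conn i x * g.comp h 0 x) * g.coframe x 1 j := by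
      intro j
      rw [key j, hcof 0 j, hcof 1 j]
      simp only [Fin.sum_univ_two, hk, rotJ]
      simp
      ring
    have hs : g.hess h x (Pi.single i 1) w
        = ∑ j, (pd i (pd j h) x - ∑ k, g.christoffel k i j x * pd k h x) * w j := by
      unfold Metric.hess
      fin_cases i <;> simp [Fin.sum_univ_two]
    rw [hs, Finset.sum_congr rfl fun j _ => congrArg (· * w j) (hj j)]
    simp only [Matrix.mulVec, dotProduct, Fin.sum_univ_two]
    ring
  have hE : ∀ a b, (g.coframe x *ᵥ fun k => g.frame x k b) a = (1 : Matrix (Fin 2) (Fin 2) ℝ) a b :=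
    fun a b => congrFun (congrFun (g.coframe_mul_frame x) a) b
  constructor
  · rw [hhess, hE, hE]; simp
  · rw [hhess, hE, hE]; simp

lemma Metric.fderiv_comp (g : Metric) {h : Plane → ℝ} {x : Plane} (hh : ContDiffAt ℝ ∞ h x)
    (v : Plane) :
    fderiv ℝ (g.comp h 0) x v = g.hess h x v (fun k => g.frame x k 0)
        + g.connForm x v * g.comp h 1 x ∧
    fderiv ℝ (g.comp h 1) x v = g.hess h x v (fun k => g.frame x k 1)
        - g.connForm x v * g.comp h 0 x := by
  have hv : ∀ w, g.hess h x v w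
      = v 0 * g.hess h x (Pi.single 0 1) w + v 1 * g.hess h x (Pi.single 1 1) w := by
    intro w
    simp only [Metric.hess, Fin.sum_univ_two]
    simp
    ring
  constructor
  · rw [fderiv_apply_eq_pd, (g.pd_comp hh 0).1, (g.pd_comp hh 1).1, hv, g.connForm_apply]
    ring
  · rw [fderiv_apply_eq_pd, (g.pd_comp hh 0).2, (g.pd_comp hh 1).2, hv, g.connForm_apply]
    ring

lemma Metric.inner_grad (g : Metric) (h : Plane → ℝ) (x : Plane) :
    g.inner x (g.grad h x) (g.grad h x) = g.comp h 0 x ^ 2 + g.comp h 1 x ^ 2 := by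
  have hgr : g.grad h x = (g.coeff x)⁻¹ *ᵥ fun l => pd l h x := rfl
  have hcov : (fun l => pd l h x) = (g.coframe x)ᵀ *ᵥ fun b => g.comp h b x := by
    funext l
    rw [pd, g.fderiv_eq_comp]
    simp only [Matrix.mulVec_single_one, Matrix.col_apply]
    simp [Matrix.mulVec, dotProduct, Fin.sum_univ_two]
    ring
  have h1 : g.coframe x *ᵥ g.grad h x = fun b => g.comp h b x := by
    rw [hgr, hcov, ← g.coframe_transpose_mul, Matrix.mul_inv_rev, Matrix.mulVec_mulVec,
      Matrix.mulVec_mulVec]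
    have : g.coframe x * ((g.coframe x)⁻¹ * (g.coframe x)ᵀ⁻¹ * (g.coframe x)ᵀ) = 1 := by
      rw [← Matrix.mul_assoc, ← Matrix.mul_assoc, Matrix.mul_nonsing_inv _ (g.isUnit_coframe x),
        Matrix.one_mul, Matrix.nonsing_inv_mul]
      rw [Matrix.det_transpose]
      exact g.isUnit_coframe x
    rw [Matrix.mul_assoc, this, Matrix.one_mulVec]
  rw [g.inner_eq, h1]
  simp [dotProduct, Fin.sum_univ_two]
  ring

/-! ### The differential in orthonormal frames -/

/-- The matrix of `Df` with respect to the orthonormal frames at `x` and `f x`. -/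
def Metric.diffMatrix (g : Metric) (f : Plane → Plane) (x : Plane) : Matrix (Fin 2) (Fin 2) ℝ :=
  g.coframe (f x) * jac f x * g.frame x

lemma Metric.diffMatrix_mul_coframe (g : Metric) (f : Plane → Plane) (x : Plane) :
    g.diffMatrix f x * g.coframe x = g.coframe (f x) * jac f x := by
  rw [Metric.diffMatrix, Matrix.mul_assoc, g.frame_mul_coframe, Matrix.mul_one]

lemma Metric.diffMatrix_mulVec (g : Metric) {f : Plane → Plane} {x : Plane}
    (hf : DifferentiableAt ℝ f x) (v : Plane) :
    g.diffMatrix f x *ᵥ (g.coframe x *ᵥ v) = g.coframe (f x) *ᵥ fderiv ℝ f x v := by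
  rw [Matrix.mulVec_mulVec, g.diffMatrix_mul_coframe, ← Matrix.mulVec_mulVec, jac_mulVec hf]

lemma Metric.det_diffMatrix (g : Metric) (f : Plane → Plane) (x : Plane) :
    (g.diffMatrix f x).det * (g.coframe x).det = (g.coframe (f x)).det * (jac f x).det := by
  rw [← Matrix.det_mul, g.diffMatrix_mul_coframe, Matrix.det_mul]

lemma contDiffAt_mul_apply {M N : Plane → Matrix (Fin 2) (Fin 2) ℝ} {x : Plane}
    (hM : ∀ a b, ContDiffAt ℝ ∞ (fun y => M y a b) x)
    (hN : ∀ a b, ContDiffAt ℝ ∞ (fun y => N y a b) x) (a b : Fin 2) :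
    ContDiffAt ℝ ∞ (fun y => (M y * N y) a b) x := by
  simp only [Matrix.mul_apply, Fin.sum_univ_two]
  exact ((hM a 0).mul (hN 0 b)).add ((hM a 1).mul (hN 1 b))

lemma Metric.contDiffAt_diffMatrix (g : Metric) {f : Plane → Plane} {x : Plane}
    (hf : ContDiffAt ℝ ∞ f x) (a b : Fin 2) :
    ContDiffAt ℝ ∞ (fun y => g.diffMatrix f y a b) x :=
  contDiffAt_mul_apply (fun a b => contDiffAt_mul_apply
    (fun a b => (g.contDiff_coframe a b).contDiffAt.comp x hf) (contDiffAt_jac hf) a b)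
    (fun a b => (g.contDiff_frame a b).contDiffAt) a b

/-- The adjoint of `Df` corresponds to the transpose in orthonormal frames. -/
lemma Metric.det_one_add_jacAdj (g : Metric) (f : Plane → Plane) (x : Plane) :
    (1 + g.jacAdj f x * jac f x).det
      = (1 + (g.diffMatrix f x)ᵀ * g.diffMatrix f x).det := by
  have hu := g.isUnit_coframe x
  have hut : IsUnit (g.coframe x)ᵀ.det := by rwa [Matrix.det_transpose]
  have h1 : g.jacAdj f x * jac f x
      = g.frame x * ((g.diffMatrix f x)ᵀ * g.diffMatrix f x) * g.coframe x := by
    rw [Matrix.mul_assoc, Matrix.mul_assoc, g.diffMatrix_mul_coframe, Metric.diffMatrix,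
      Matrix.transpose_mul, Matrix.transpose_mul, Metric.jacAdj, Metric.frame,
      ← g.coframe_transpose_mul x, ← g.coframe_transpose_mul (f x), Matrix.mul_inv_rev,
      Matrix.transpose_nonsing_inv]
    simp only [Matrix.mul_assoc]
  have h2 : 1 + g.jacAdj f x * jac f x
      = g.frame x * (1 + (g.diffMatrix f x)ᵀ * g.diffMatrix f x) * g.coframe x := by
    rw [h1, Matrix.mul_add, Matrix.add_mul, Matrix.mul_one, g.frame_mul_coframe]
  rw [h2, Matrix.det_mul, Matrix.det_mul, mul_right_comm, ← Matrix.det_mul, g.frame_mul_coframe,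
    Matrix.det_one, one_mul]

/-! ### Area preserving maps -/

lemma det_fderiv {f : Plane → Plane} {x : Plane} (h : DifferentiableAt ℝ f x) :
    (fderiv ℝ f x).det = (jac f x).det := by
  have : (fderiv ℝ f x : Plane →ₗ[ℝ] Plane) = Matrix.toLin' (jac f x) :=
    LinearMap.ext fun v => (jac_mulVec h v).symm
  rw [ContinuousLinearMap.det, this, LinearMap.det_toLin']

/-- An area preserving diffeomorphism has unit Jacobian at interior points. -/
lemma IsMinimalLagrangianDiffeo.jac_det_interior {g : Metric} {f : Plane → Plane}
    {Ω Ω' : Set Plane} (hf : IsMinimalLagrangianDiffeo g f Ω Ω') {x : Plane}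
    (hx : x ∈ interior Ω) :
    (jac f x).det * (g.coframe (f x)).det = (g.coframe x).det := by
  obtain ⟨hfs, f', -, -, -, hinv⟩ := hf.diffeo
  have hO : ∀ y ∈ interior Ω, ContDiffAt ℝ ∞ f y := fun y hy =>
    hfs.contDiffAt (interior_subset hy)
  have hpos := fun y (hy : y ∈ interior Ω) => hf.orientationPreserving y (interior_subset hy)
  set φ : Plane → ℝ := fun y => |(fderiv ℝ f y).det| * (g.coframe (f y)).det with hφ
  set ψ : Plane → ℝ := fun y => (g.coframe y).det with hψ
  have hcof : Continuous (fun y => (g.coframe y).det) := by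
    simp only [Matrix.det_fin_two]
    have := fun a b => (g.contDiff_coframe a b).continuous
    exact ((this 0 0).mul (this 1 1)).sub ((this 0 1).mul (this 1 0))
  have hφc : ContinuousOn φ (interior Ω) := by
    intro y hy
    refine ContinuousAt.continuousWithinAt (ContinuousAt.mul ?_ ?_)
    · have h1 : ContinuousAt (fderiv ℝ f) y :=
        ((hO y hy).fderiv_right (m := ∞) (by simp)).continuousAt
      exact (ContinuousLinearMap.continuous_det.continuousAt.comp h1).abs
    · exact hcof.continuousAt.comp (hO y hy).continuousAt
  have hlint : ∀ A ⊆ interior Ω, MeasurableSet A →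
      ∫⁻ y in A, ENNReal.ofReal (φ y) = ∫⁻ y in A, ENNReal.ofReal (ψ y) := by
    intro A hA hAm
    have h1 := hf.areaPreserving A (hA.trans interior_subset) hAm
    simp only [Metric.area, withDensity_apply', g.sqrt_det_coeff] at h1
    rw [lintegral_image_eq_lintegral_abs_det_fderiv_mul volume hAm
      (fun y hy => ((hO y (hA hy)).differentiableAt (by simp)).hasFDerivAt.hasFDerivWithinAt)
      (hinv.1.injOn.mono (hA.trans interior_subset))] at h1
    rw [← h1]
    refine lintegral_congr fun y => ?_
    rw [hφ, ENNReal.ofReal_mul (abs_nonneg _)]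
  -- Area preservation on every measurable subset identifies the two densities almost everywhere;
  -- their continuity then makes them equal at every interior point.
  have hae : (fun y => ENNReal.ofReal (φ y)) =ᵐ[volume.restrict (interior Ω)]
      fun y => ENNReal.ofReal (ψ y) := by
    refine ae_eq_of_forall_setLIntegral_eq_of_sigmaFinite₀
      (hφc.aemeasurable isOpen_interior.measurableSet).ennreal_ofReal
      hcof.measurable.ennreal_ofReal.aemeasurable fun A hA _ => ?_
    rw [Measure.restrict_restrict hA]
    exact hlint _ Set.inter_subset_right (hA.inter isOpen_interior.measurableSet)
  have heq := Measure.eqOn_open_of_ae_eq hae isOpen_interior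
    (ENNReal.continuous_ofReal.comp_continuousOn hφc)
    (ENNReal.continuous_ofReal.comp hcof).continuousOn hx
  have hφψ : φ x = ψ x := by
    refine (ENNReal.ofReal_eq_ofReal_iff ?_ (g.coframe_det_pos x).le).1 heq
    exact mul_nonneg (abs_nonneg _) (g.coframe_det_pos _).le
  simp only [hφ, hψ, det_fderiv ((hO x hx).differentiableAt (by simp)),
    abs_of_pos (hpos x hx)] at hφψ
  exact hφψ

lemma IsMinimalLagrangianDiffeo.contDiffAt {g : Metric} {f : Plane → Plane}
    {Ω Ω' : Set Plane} (hf : IsMinimalLagrangianDiffeo g f Ω Ω') {x : Plane} (hx : x ∈ Ω) :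
    ContDiffAt ℝ ∞ f x :=
  hf.diffeo.1.contDiffAt hx

lemma IsMinimalLagrangianDiffeo.mapsTo {g : Metric} {f : Plane → Plane}
    {Ω Ω' : Set Plane} (hf : IsMinimalLagrangianDiffeo g f Ω Ω') {x : Plane} (hx : x ∈ Ω) :
    f x ∈ Ω' := by
  obtain ⟨-, f', -, h, -⟩ := hf.diffeo
  exact h hx

lemma IsMinimalLagrangianDiffeo.det_diffMatrix_interior {g : Metric} {f : Plane → Plane}
    {Ω Ω' : Set Plane} (hf : IsMinimalLagrangianDiffeo g f Ω Ω') {x : Plane}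
    (hx : x ∈ interior Ω) : (g.diffMatrix f x).det = 1 := by
  have h := g.det_diffMatrix f x
  rw [mul_comm (g.coframe (f x)).det, hf.jac_det_interior hx] at h
  exact mul_right_cancel₀ (g.coframe_det_pos x).ne' (h.trans (one_mul _).symm)

lemma IsMinimalLagrangianDiffeo.det_diffMatrix {g : Metric} {f : Plane → Plane}
    {Ω Ω' : Set Plane} (hf : IsMinimalLagrangianDiffeo g f Ω Ω')
    (hΩ : IsStrictlyConvexDomain g Ω) {x : Plane} (hx : x ∈ Ω) :
    (g.diffMatrix f x).det = 1 := by
  refine hΩ.eq_of_eqOn_interior (φ := fun y => (g.diffMatrix f y).det) (ψ := fun _ => 1) hx ?_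
    continuousAt_const fun y hy => hf.det_diffMatrix_interior hy
  have := fun a b => (g.contDiffAt_diffMatrix (hf.contDiffAt hx) a b).continuousAt
  simp only [Matrix.det_fin_two]
  exact ((this 0 0).mul (this 1 1)).sub ((this 0 1).mul (this 1 0))

/-! ### Minimality -/

/-- The coordinate components `B(∂ᵢ, ∂ⱼ)ᵏ`, as a matrix in `k, j`, of the covariant derivative of
`Df` in the direction `∂ᵢ`. -/
def Metric.covDiff (g : Metric) (f : Plane → Plane) (i : Fin 2) (x : Plane) :
    Matrix (Fin 2) (Fin 2) ℝ :=
  pdMatrix i (jac f) x + (∑ a, jac f x a i • g.gammaMatrix a (f x)) * jac f x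
    - jac f x * g.gammaMatrix i x

/-- Mixed partial derivatives commute and both connections are torsion free. -/
lemma Metric.covDiff_comm (g : Metric) {f : Plane → Plane} {x : Plane}
    (hf : ContDiffAt ℝ ∞ f x) (i j k : Fin 2) : g.covDiff f i x k j = g.covDiff f j x k i := by
  have h1 : pdMatrix i (jac f) x k j = pdMatrix j (jac f) x k i :=
    pd_pd_comm (contDiffAt_pi.1 hf k) i j
  simp only [Metric.covDiff, Matrix.sub_apply, Matrix.add_apply, h1, Matrix.mul_apply,
    Fin.sum_univ_two, Metric.gammaMatrix, Matrix.smul_apply, Matrix.of_apply, smul_eq_mul,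
    g.christoffel_comm _ i j, g.christoffel_comm _ 1 0]
  ring

lemma Metric.inner_self_eq_zero (g : Metric) {x v : Plane} (h : g.inner x v v = 0) : v = 0 := by
  by_contra hv
  have := (g.posDef x).dotProduct_mulVec_pos hv
  simp only [star_trivial] at this
  rw [Metric.inner] at h
  linarith

/-- Minimality of the graph: the trace of the covariant derivative of `Df` vanishes. -/
lemma Metric.IsMinimalGraph.graphNabla_eq {g : Metric} {f : Plane → Plane} {Ω : Set Plane}
    (hf : g.IsMinimalGraph f Ω) {x : Plane} (hx : x ∈ Ω) {e : Fin 2 → Plane}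
    (he : ∀ i j, g.prodInner x (f x) (graphTangent f x (e i)) (graphTangent f x (e j))
      = if i = j then 1 else 0) :
    (∑ i, g.graphNabla f x (e i) (e i)).2 = jac f x *ᵥ (∑ i, g.graphNabla f x (e i) (e i)).1 := by
  set V := ∑ i, g.graphNabla f x (e i) (e i) with hV
  set u := V.2 - jac f x *ᵥ V.1 with hu
  have hadj : ∀ v, g.inner x (g.jacAdj f x *ᵥ u) v = g.inner (f x) u (jac f x *ᵥ v) := by
    intro v
    have hT : (g.jacAdj f x)ᵀ * g.coeff x = g.coeff (f x) * jac f x := by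
      have hs : ∀ y, (g.coeff y)ᵀ = g.coeff y := fun y => by
        ext i j; exact g.coeff_comm y j i
      rw [Metric.jacAdj, Matrix.transpose_mul, Matrix.transpose_mul, Matrix.transpose_nonsing_inv,
        hs, hs, Matrix.transpose_transpose, Matrix.mul_assoc, Matrix.mul_assoc,
        Matrix.nonsing_inv_mul _ (g.posDef x).det_pos.ne'.isUnit, Matrix.mul_one]
    rw [Metric.inner, Metric.inner, Matrix.mulVec_mulVec, ← hT, ← Matrix.mulVec_mulVec,
      Matrix.dotProduct_mulVec u, Matrix.vecMul_transpose]
  -- `(-Df* u, u)` is normal to the graph, and its product with the trace vector `V` is `⟨u, V.2 -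
  -- Df V.1⟩ = |u|²`.
  have hnormal := hf x hx e he (-(g.jacAdj f x *ᵥ u), u) (fun v => by
    have := hadj v
    simp only [Metric.prodInner, graphTangent, Metric.inner, neg_dotProduct] at this ⊢
    linarith)
  have hcomm : ∀ y v w, g.inner y v w = g.inner y w v := fun y v w => by
    rw [g.inner_eq, g.inner_eq, dotProduct_comm]
  have h0 : g.inner (f x) u u = 0 := by
    rw [← hV, Metric.prodInner] at hnormal
    simp only at hnormal
    rw [hcomm x, hcomm (f x) V.2] at hnormal
    have h1 := hadj V.1
    have h2 : g.inner (f x) u u = g.inner (f x) u V.2 - g.inner (f x) u (jac f x *ᵥ V.1) := by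
      simp only [Metric.inner, hu, Matrix.mulVec_sub, dotProduct_sub]
    simp only [Metric.inner, neg_dotProduct] at hnormal h1 h2 ⊢
    linarith
  have := g.inner_self_eq_zero h0
  exact sub_eq_zero.1 this

lemma exists_orthonormal {M : Matrix (Fin 2) (Fin 2) ℝ} (h : M.PosDef) :
    ∃ e : Fin 2 → Plane, ∀ i j, e i ⬝ᵥ (M *ᵥ e j) = if i = j then 1 else 0 := by
  have hu : IsUnit (cholesky M).det := (cholesky_det_pos h).ne'.isUnit
  set E := (cholesky M)⁻¹
  refine ⟨fun i k => E k i, fun i j => ?_⟩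
  have h1 : Eᵀ * M * E = 1 := by
    conv_lhs => rw [← cholesky_transpose_mul h]
    rw [← Matrix.mul_assoc, Matrix.mul_assoc, Matrix.mul_nonsing_inv _ hu, Matrix.mul_one,
      ← Matrix.transpose_mul, Matrix.mul_nonsing_inv _ hu, Matrix.transpose_one]
  have h2 := congrFun (congrFun h1 i) j
  rw [Matrix.one_apply] at h2
  rw [← h2, Matrix.mul_assoc]
  rfl

/-- An orthonormal basis of the tangent space of the graph, in coordinates. -/
lemma Metric.exists_graph_orthonormal (g : Metric) (f : Plane → Plane) (x : Plane) :
    ∃ e : Fin 2 → Plane, ∀ i j,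
      g.prodInner x (f x) (graphTangent f x (e i)) (graphTangent f x (e j))
        = if i = j then 1 else 0 := by
  have hpd : (g.coeff x + (jac f x)ᵀ * g.coeff (f x) * jac f x).PosDef := by
    refine (g.posDef x).add_posSemidef ?_
    have := (g.posDef (f x)).posSemidef.conjTranspose_mul_mul_same (jac f x)
    simpa using this
  obtain ⟨e, he⟩ := exists_orthonormal hpd
  refine ⟨e, fun i j => ?_⟩
  rw [← he i j, Metric.prodInner, graphTangent, graphTangent, Metric.inner, Metric.inner,
    Matrix.add_mulVec, dotProduct_add]
  congr 1
  rw [Matrix.mul_assoc, ← Matrix.mulVec_mulVec, ← Matrix.mulVec_mulVec,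
    Matrix.dotProduct_mulVec (e i),
    Matrix.vecMul_transpose]

/-! ### The rotation part of the differential is parallel -/

/-- A symmetric trace condition on the derivative `β` of a matrix `F` of positive determinant:
if `β` preserves the determinant of `F` and its trace with respect to `1 + FᵀF` vanishes, then `β`
does not change the argument of the conformal part of `F`. -/
lemma conformal_arg_stationary {F : Matrix (Fin 2) (Fin 2) ℝ}
    {β : Fin 2 → Matrix (Fin 2) (Fin 2) ℝ} (hdet : F.det = 1)
    (hsymm : ∀ a b k, β a k b = β b k a) (htr : ∀ a, (F.adjugate * β a).trace = 0)
    (hmin : ∀ k, ∑ a, ∑ b, (1 + Fᵀ * F).adjugate a b * β a k b = 0) (a : Fin 2) :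
    (F 0 0 + F 1 1) * (β a 1 0 - β a 0 1) - (F 1 0 - F 0 1) * (β a 0 0 + β a 1 1) = 0 := by
  have ht0 := htr 0
  have ht1 := htr 1
  have hm0 := hmin 0
  have hm1 := hmin 1
  have hs0 := hsymm 1 0 0
  have hs1 := hsymm 1 0 1
  simp only [Matrix.adjugate_fin_two, Matrix.trace_fin_two, Matrix.mul_apply, Fin.sum_univ_two,
    Matrix.add_apply, Matrix.transpose_apply, Matrix.of_apply, Matrix.cons_val',
    Matrix.cons_val_zero,
    Matrix.cons_val_one, Matrix.one_apply_eq, Matrix.one_apply_ne (zero_ne_one (α := Fin 2)),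
    Matrix.one_apply_ne (one_ne_zero (α := Fin 2)), Matrix.cons_val_fin_one,
    hs0, hs1] at ht0 ht1 hm0 hm1
  rw [Matrix.det_fin_two] at hdet
  -- Here `z` and `w` are the conformal and anticonformal parts of `F`, with `|z|² - |w|² = 4 det
  -- F`. Why the identity holds: by `hsymm` and `htr` the form `ω(β_a e_b, F e_c)`, with `ω` the
  -- area form, is symmetric in all three indices. For `F = R P` with `det P = 1`, Cayley-Hamilton
  -- gives `1 + FᵀF = 1 + P² = (tr P) P`. The trace with its inverse, zero by `hmin`, is therefore
  -- proportional to `∑ ω(β_a e_b, F P⁻¹ e_b) = ∑ ω(β_a e_b, R e_b)`, the antisymmetric part of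
  -- `Rᵀβ_a`. Its vanishing says that the argument of `z` is stationary.
  set z0 := F 0 0 + F 1 1 with hz0
  set z1 := F 1 0 - F 0 1 with hz1
  set w0 := F 0 0 - F 1 1 with hw0
  set w1 := F 1 0 + F 0 1 with hw1
  obtain rfl | rfl : a = 0 ∨ a = 1 := by omega
  · linear_combination (1 / 2) * (-(z0 ^ 2 + z1 ^ 2) * ht1 - z1 * hm0 + z0 * hm1
      - (w0 * z0 + w1 * z1) * ht1 - (w0 * z1 - w1 * z0) * ht0 + w0 * hm1 - w1 * hm0)
      + (1 / 2) * ((-z1 - w1) * (β 0 0 0 + β 1 0 1) + (z0 + w0) * (β 0 1 0 + β 1 1 1)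
        - 2 * (z0 * (β 0 1 0 - β 0 0 1) - z1 * (β 0 0 0 + β 0 1 1))) * hdet
  · rw [hs0, hs1]
    linear_combination (1 / 2) * ((z0 ^ 2 + z1 ^ 2) * ht0 - z0 * hm0 - z1 * hm1
      - (w0 * z0 + w1 * z1) * ht0 + (w0 * z1 - w1 * z0) * ht1 + w0 * hm0 + w1 * hm1)
      + (1 / 2) * ((-z0 + w0) * (β 0 0 0 + β 1 0 1) + (-z1 + w1) * (β 0 1 0 + β 1 1 1)
        - 2 * (z0 * (β 0 1 1 - β 1 0 1) - z1 * (β 0 0 1 + β 1 1 1))) * hdet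

lemma pd_comp_map {ψ : Plane → ℝ} {f : Plane → Plane} {x : Plane}
    (hψ : DifferentiableAt ℝ ψ (f x)) (hf : DifferentiableAt ℝ f x) (i : Fin 2) :
    pd i (fun y => ψ (f y)) x = jac f x 0 i * pd 0 ψ (f x) + jac f x 1 i * pd 1 ψ (f x) := by
  have h : fderiv ℝ (fun y => ψ (f y)) x = fderiv ℝ ψ (f x) ∘L fderiv ℝ f x :=
    fderiv_comp x hψ hf
  rw [pd, h, ContinuousLinearMap.comp_apply, fderiv_apply_eq_pd, jac_apply hf, jac_apply hf]

/-- The derivative of the matrix of `Df` in orthonormal frames. -/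
lemma Metric.pdMatrix_diffMatrix (g : Metric) {f : Plane → Plane} {x : Plane}
    (hf : ContDiffAt ℝ ∞ f x) (i : Fin 2) :
    pdMatrix i (g.diffMatrix f) x = g.coframe (f x) * g.covDiff f i x * g.frame x
      - (g.connForm (f x) (fderiv ℝ f x (Pi.single i 1))) • (rotJ * g.diffMatrix f x)
      + g.conn i x • (g.diffMatrix f x * rotJ) := by
  have hfd : DifferentiableAt ℝ f x := hf.differentiableAt (by simp)
  have hS : ∀ y a b, DifferentiableAt ℝ (fun y => g.coframe y a b) y := fun y a b =>
    (g.contDiff_coframe a b).contDiffAt.differentiableAt (by simp)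
  have hF : ∀ a b, DifferentiableAt ℝ (fun y => g.diffMatrix f y a b) x := fun a b =>
    (g.contDiffAt_diffMatrix hf a b).differentiableAt (by simp)
  have hSf : ∀ a b, DifferentiableAt ℝ (fun y => g.coframe (f y) a b) x := fun a b =>
    (hS (f x) a b).comp x hfd
  -- Differentiating the relation `F S = S' A`, instead of the formula for `F`, avoids derivatives
  -- of the inverse coframe.
  have hJ : ∀ a b, DifferentiableAt ℝ (fun y => jac f y a b) x := fun a b =>
    (contDiffAt_jac hf a b).differentiableAt (by simp)
  have h1 := pdMatrix_mul i hF (hS x)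
  simp only [g.diffMatrix_mul_coframe] at h1
  rw [pdMatrix_mul i hSf hJ] at h1
  have h2 : pdMatrix i (fun y => g.coframe (f y)) x
      = g.coframe (f x) * (∑ a, jac f x a i • g.gammaMatrix a (f x))
        - (g.connForm (f x) (fderiv ℝ f x (Pi.single i 1))) • (rotJ * g.coframe (f x)) := by
    have h3 : pdMatrix i (fun y => g.coframe (f y)) x
        = jac f x 0 i • pdMatrix 0 g.coframe (f x) + jac f x 1 i • pdMatrix 1 g.coframe (f x) := by
      ext a b
      exact pd_comp_map (hS (f x) a b) hfd i
    rw [h3, g.pdMatrix_coframe, g.pdMatrix_coframe, g.connForm_apply, ← jac_apply hfd,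
      ← jac_apply hfd, Fin.sum_univ_two, Matrix.mul_add, Matrix.mul_smul, Matrix.mul_smul]
    module
  rw [h2, g.pdMatrix_coframe] at h1
  have hFS := g.diffMatrix_mul_coframe f x
  have hSE := g.coframe_mul_frame x
  have h4 := congrArg (· * g.frame x) h1
  simp only [Metric.covDiff]
  generalize g.connForm (f x) (fderiv ℝ f x (Pi.single i 1)) = α' at *
  generalize g.conn i x = α at *
  generalize hG' : ∑ a, jac f x a i • g.gammaMatrix a (f x) = Γ' at *
  generalize g.gammaMatrix i x = Γ at *
  generalize pdMatrix i (jac f) x = DJ at *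
  generalize pdMatrix i (g.diffMatrix f) x = DF at *
  generalize g.diffMatrix f x = F at *
  generalize g.coframe (f x) = S' at *
  generalize g.coframe x = S at *
  generalize g.frame x = E at *
  generalize jac f x = A at *
  have hFE : S' * A * E = F := by rw [← hFS, Matrix.mul_assoc, hSE, Matrix.mul_one]
  have e1 : (DF * S + F * (S * Γ - α • (rotJ * S))) * E
      = DF + S' * A * Γ * E - α • (F * rotJ) := by
    calc _ = DF * (S * E) + (F * S) * Γ * E - α • (F * rotJ * (S * E)) := by
          simp only [Matrix.mul_sub, Matrix.add_mul, Matrix.sub_mul, Matrix.mul_smul,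
            Matrix.smul_mul, Matrix.mul_assoc]
          abel
      _ = _ := by rw [hSE, hFS, Matrix.mul_one, Matrix.mul_one]
  have e2 : ((S' * Γ' - α' • (rotJ * S')) * A + S' * DJ) * E
      = S' * (Γ' * A) * E - α' • (rotJ * F) + S' * DJ * E := by
    rw [← hFE]
    simp only [Matrix.add_mul, Matrix.sub_mul, Matrix.smul_mul, Matrix.mul_assoc]
  rw [e1, e2] at h4
  have h5 : DF = S' * (Γ' * A) * E - α' • (rotJ * F) + S' * DJ * E
      - S' * A * Γ * E + α • (F * rotJ) := by
    rw [h4]; abel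
  rw [h5]
  simp only [Matrix.mul_add, Matrix.mul_sub, Matrix.add_mul, Matrix.sub_mul, Matrix.mul_assoc]
  abel

lemma Metric.prodInner_graphTangent (g : Metric) {f : Plane → Plane} {x : Plane}
    (hf : DifferentiableAt ℝ f x) (v w : Plane) :
    g.prodInner x (f x) (graphTangent f x v) (graphTangent f x w)
      = (g.coframe x *ᵥ v) ⬝ᵥ
        ((1 + (g.diffMatrix f x)ᵀ * g.diffMatrix f x) *ᵥ (g.coframe x *ᵥ w)) := by
  rw [Metric.prodInner, graphTangent, graphTangent, g.inner_eq, g.inner_eq, jac_mulVec hf,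
    jac_mulVec hf, ← g.diffMatrix_mulVec hf, ← g.diffMatrix_mulVec hf, Matrix.add_mulVec,
    dotProduct_add, Matrix.one_mulVec]
  congr 1
  rw [← Matrix.mulVec_mulVec _ (g.diffMatrix f x)ᵀ, Matrix.dotProduct_mulVec (g.coframe x *ᵥ v),
    Matrix.vecMul_transpose]

/-- For a basis orthonormal with respect to `M`, the sum of the squares is the inverse of `M`. -/
lemma sum_mul_of_orthonormal {M : Matrix (Fin 2) (Fin 2) ℝ} {ξ : Fin 2 → Plane}
    (h : ∀ i j, ξ i ⬝ᵥ (M *ᵥ ξ j) = if i = j then 1 else 0) (a b : Fin 2) :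
    M.det * ∑ m, ξ m a * ξ m b = M.adjugate a b := by
  set N : Matrix (Fin 2) (Fin 2) ℝ := .of fun a m => ξ m a with hN
  have h1 : Nᵀ * (M * N) = 1 := by
    ext i j
    rw [Matrix.one_apply, ← h i j]
    rfl
  have h2 : M * (N * Nᵀ) = 1 := by
    rw [← Matrix.mul_assoc]
    exact mul_eq_one_comm.1 h1
  have h3 : M.det • (N * Nᵀ) = M.adjugate := by
    calc M.det • (N * Nᵀ) = (M.adjugate * M) * (N * Nᵀ) := by
          rw [Matrix.adjugate_mul, Matrix.smul_mul, Matrix.one_mul]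
      _ = M.adjugate := by rw [Matrix.mul_assoc, h2, Matrix.mul_one]
  have h4 := congrFun (congrFun h3 a) b
  simpa [Matrix.mul_apply, hN] using h4

/-- Minimality in coordinates: the trace of `∇Df` in the graph metric vanishes, because the
tangential and normal parts separate in `graphNabla_eq`. -/
lemma Metric.covDiff_trace (g : Metric) {f : Plane → Plane} {Ω : Set Plane}
    (hf : g.IsMinimalGraph f Ω) {x : Plane} (hx : x ∈ Ω) {e : Fin 2 → Plane}
    (he : ∀ i j, g.prodInner x (f x) (graphTangent f x (e i)) (graphTangent f x (e j))
      = if i = j then 1 else 0) (k : Fin 2) :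
    ∑ m, ∑ i, ∑ j, g.covDiff f i x k j * e m i * e m j = 0 := by
  have h := congrFun (hf.graphNabla_eq hx he) k
  simp only [Fin.sum_univ_two, Metric.graphNabla, Metric.gamma, Prod.snd_add, Prod.fst_add,
    Pi.add_apply, Matrix.mulVec, dotProduct] at h
  simp only [Metric.covDiff, Fin.sum_univ_two, Matrix.sub_apply, Matrix.add_apply,
    Matrix.mul_apply, Matrix.smul_apply, Metric.gammaMatrix, pdMatrix, Matrix.of_apply, smul_eq_mul]
  simp only [jac] at h ⊢
  linear_combination h

/-- The real part of the conformal part of `Df`. -/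
def Metric.confRe (g : Metric) (f : Plane → Plane) (x : Plane) : ℝ :=
  g.diffMatrix f x 0 0 + g.diffMatrix f x 1 1

/-- The imaginary part of the conformal part of `Df`. -/
def Metric.confIm (g : Metric) (f : Plane → Plane) (x : Plane) : ℝ :=
  g.diffMatrix f x 1 0 - g.diffMatrix f x 0 1

/-- The modulus of the conformal part of `Df`. -/
def Metric.confAbs (g : Metric) (f : Plane → Plane) (x : Plane) : ℝ :=
  √(g.confRe f x ^ 2 + g.confIm f x ^ 2)

/-- The cosine of the angle of the rotation in the polar decomposition of `Df`. -/
def Metric.rotCos (g : Metric) (f : Plane → Plane) (x : Plane) : ℝ :=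
  g.confRe f x / g.confAbs f x

/-- The sine of the angle of the rotation in the polar decomposition of `Df`. -/
def Metric.rotSin (g : Metric) (f : Plane → Plane) (x : Plane) : ℝ :=
  g.confIm f x / g.confAbs f x

/-! ### Polar decomposition of a matrix of determinant one -/

section rotation

variable {g : Metric} {f : Plane → Plane} {x : Plane}

/-- For any 2×2 matrix the squared modulus here is `|F|² + 2 det F`. -/
lemma Metric.conf_sq_eq (hdet : (g.diffMatrix f x).det = 1) :
    g.confRe f x ^ 2 + g.confIm f x ^ 2 = 2 + (g.diffMatrix f x 0 0 ^ 2 + g.diffMatrix f x 0 1 ^ 2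
      + g.diffMatrix f x 1 0 ^ 2 + g.diffMatrix f x 1 1 ^ 2) := by
  rw [Matrix.det_fin_two] at hdet
  rw [Metric.confRe, Metric.confIm]
  linear_combination 2 * hdet

lemma Metric.conf_sq_pos (hdet : (g.diffMatrix f x).det = 1) :
    0 < g.confRe f x ^ 2 + g.confIm f x ^ 2 := by
  rw [Metric.conf_sq_eq hdet]
  positivity

lemma Metric.confAbs_pos (hdet : (g.diffMatrix f x).det = 1) : 0 < g.confAbs f x :=
  Real.sqrt_pos.2 (Metric.conf_sq_pos hdet)

lemma Metric.confAbs_sq : g.confAbs f x ^ 2 = g.confRe f x ^ 2 + g.confIm f x ^ 2 :=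
  Real.sq_sqrt (by positivity)

/-- `det (1 + FᵀF) = 1 + |F|² + (det F)²`. This turns the determinant to be estimated into `confAbs
^ 2`. -/
lemma Metric.det_one_add_eq (hdet : (g.diffMatrix f x).det = 1) :
    (1 + (g.diffMatrix f x)ᵀ * g.diffMatrix f x).det = g.confAbs f x ^ 2 := by
  rw [Metric.confAbs_sq, Metric.conf_sq_eq hdet]
  rw [Matrix.det_fin_two] at hdet
  simp [Matrix.det_fin_two, Matrix.mul_apply, Fin.sum_univ_two]
  linear_combination (g.diffMatrix f x 0 0 * g.diffMatrix f x 1 1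
    - g.diffMatrix f x 0 1 * g.diffMatrix f x 1 0 + 1) * hdet

lemma Metric.rotCos_mul (hdet : (g.diffMatrix f x).det = 1) :
    g.rotCos f x * g.confAbs f x = g.confRe f x :=
  div_mul_cancel₀ _ (Metric.confAbs_pos hdet).ne'

lemma Metric.rotSin_mul (hdet : (g.diffMatrix f x).det = 1) :
    g.rotSin f x * g.confAbs f x = g.confIm f x :=
  div_mul_cancel₀ _ (Metric.confAbs_pos hdet).ne'

lemma Metric.rot_sq (hdet : (g.diffMatrix f x).det = 1) :
    g.rotCos f x ^ 2 + g.rotSin f x ^ 2 = 1 := by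
  have h := Metric.confAbs_pos hdet
  rw [Metric.rotCos, Metric.rotSin, div_pow, div_pow, ← add_div, ← Metric.confAbs_sq]
  field_simp

lemma Metric.contDiffAt_confRe (hf : ContDiffAt ℝ ∞ f x) : ContDiffAt ℝ ∞ (g.confRe f) x :=
  (g.contDiffAt_diffMatrix hf 0 0).add (g.contDiffAt_diffMatrix hf 1 1)

lemma Metric.contDiffAt_confIm (hf : ContDiffAt ℝ ∞ f x) : ContDiffAt ℝ ∞ (g.confIm f) x :=
  (g.contDiffAt_diffMatrix hf 1 0).sub (g.contDiffAt_diffMatrix hf 0 1)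

lemma Metric.contDiffAt_confAbs (hf : ContDiffAt ℝ ∞ f x) (hdet : (g.diffMatrix f x).det = 1) :
    ContDiffAt ℝ ∞ (g.confAbs f) x :=
  (((Metric.contDiffAt_confRe hf).pow 2).add ((Metric.contDiffAt_confIm hf).pow 2)).sqrt
    (Metric.conf_sq_pos hdet).ne'

lemma Metric.contDiffAt_rotCos (hf : ContDiffAt ℝ ∞ f x) (hdet : (g.diffMatrix f x).det = 1) :
    ContDiffAt ℝ ∞ (g.rotCos f) x :=
  (Metric.contDiffAt_confRe hf).div (Metric.contDiffAt_confAbs hf hdet)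
    (Metric.confAbs_pos hdet).ne'

lemma Metric.contDiffAt_rotSin (hf : ContDiffAt ℝ ∞ f x) (hdet : (g.diffMatrix f x).det = 1) :
    ContDiffAt ℝ ∞ (g.rotSin f) x :=
  (Metric.contDiffAt_confIm hf).div (Metric.contDiffAt_confAbs hf hdet)
    (Metric.confAbs_pos hdet).ne'

end rotation

/-- The argument of the conformal part of `Df` varies like the difference of the connection
forms. -/
lemma IsMinimalLagrangianDiffeo.pd_conf {g : Metric} {f : Plane → Plane}
    {Ω Ω' : Set Plane} (hf : IsMinimalLagrangianDiffeo g f Ω Ω') {x : Plane}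
    (hx : x ∈ interior Ω) (i : Fin 2) :
    g.confRe f x * pd i (g.confIm f) x - g.confIm f x * pd i (g.confRe f) x
      = (g.conn i x - g.connForm (f x) (fderiv ℝ f x (Pi.single i 1)))
        * (g.confRe f x ^ 2 + g.confIm f x ^ 2) := by
  have hxΩ := interior_subset hx
  have hfx := hf.contDiffAt hxΩ
  have hdet := hf.det_diffMatrix_interior hx
  have hF : ∀ a b, DifferentiableAt ℝ (fun y => g.diffMatrix f y a b) x := fun a b =>
    (g.contDiffAt_diffMatrix hfx a b).differentiableAt (by simp)
  set N : Fin 2 → Matrix (Fin 2) (Fin 2) ℝ :=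
    fun i => g.coframe (f x) * g.covDiff f i x * g.frame x with hN
  have hD : ∀ i a b, pd i (fun y => g.diffMatrix f y a b) x = N i a b
      - (g.connForm (f x) (fderiv ℝ f x (Pi.single i 1))) * (rotJ * g.diffMatrix f x) a b
      + g.conn i x * (g.diffMatrix f x * rotJ) a b := fun i a b =>
    congrFun (congrFun (g.pdMatrix_diffMatrix hfx i) a) b
  have hJ00 : rotJ 0 0 = 0 := rfl
  have hJ01 : rotJ 0 1 = -1 := rfl
  have hJ10 : rotJ 1 0 = 1 := rfl
  have hJ11 : rotJ 1 1 = 0 := rfl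
  simp only [Matrix.mul_apply, Fin.sum_univ_two] at hD
  -- Derivative of `det F = 1`. The connection terms drop out, since `adj F · rotJ F` and `adj F · F
  -- rotJ` have trace `det F · tr rotJ = 0`.
  have htrace : ∀ i, ((g.diffMatrix f x).adjugate * N i).trace = 0 := by
    intro i
    have hev : (fun y => g.diffMatrix f y 0 0 * g.diffMatrix f y 1 1
        + (-1) * (g.diffMatrix f y 0 1 * g.diffMatrix f y 1 0)) =ᶠ[𝓝 x] fun _ => 1 := by
      filter_upwards [isOpen_interior.mem_nhds hx] with y hy
      have := hf.det_diffMatrix_interior hy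
      rw [Matrix.det_fin_two] at this
      linarith
    have h0 := pd_congr i hev
    rw [pd_add i ((hF 0 0).fun_mul (hF 1 1)) (((hF 0 1).fun_mul (hF 1 0)).const_mul (-1)),
      pd_mul i (hF 0 0) (hF 1 1), pd_mul i (differentiableAt_const (-1 : ℝ))
      ((hF 0 1).fun_mul (hF 1 0)), pd_mul i (hF 0 1) (hF 1 0), hD, hD, hD, hD] at h0
    have hc : ∀ c : ℝ, pd i (fun _ => c) x = 0 := fun c => by simp [pd]
    rw [hc, hc] at h0
    simp only [hJ00, hJ01, hJ10, hJ11] at h0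
    simp only [Matrix.adjugate_fin_two, Matrix.trace_fin_two, Matrix.mul_apply, Fin.sum_univ_two,
      Matrix.of_apply, Matrix.cons_val', Matrix.cons_val_zero, Matrix.cons_val_one,
      Matrix.cons_val_fin_one]
    linear_combination h0
  obtain ⟨e, he⟩ := g.exists_graph_orthonormal f x
  -- Passing from coordinate directions to frame directions puts both lower indices in the same
  -- orthonormal frame, where the symmetry and the trace condition take the form required by
  -- `conformal_arg_stationary`.
  set β : Fin 2 → Matrix (Fin 2) (Fin 2) ℝ := fun a => ∑ i, g.frame x i a • N i with hβ
  have hNβ : ∀ i, N i = g.coframe x 0 i • β 0 + g.coframe x 1 i • β 1 := by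
    intro i
    have h := g.frame_mul_coframe x
    have h' := fun j => congrFun (congrFun h j) i
    simp only [Matrix.mul_apply, Fin.sum_univ_two] at h'
    simp only [hβ, Fin.sum_univ_two, smul_add, smul_smul]
    have : N i = (1 : Matrix (Fin 2) (Fin 2) ℝ) 0 i • N 0
        + (1 : Matrix (Fin 2) (Fin 2) ℝ) 1 i • N 1 := by
      obtain rfl | rfl : i = 0 ∨ i = 1 := by omega
      all_goals simp
    rw [this, ← h' 0, ← h' 1]
    module
  have hsymm : ∀ a b k, β a k b = β b k a := by
    intro a b k
    have h01 := g.covDiff_comm hfx 1 0 0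
    have h11 := g.covDiff_comm hfx 1 0 1
    simp only [hβ, hN, Fin.sum_univ_two, Matrix.add_apply, Matrix.smul_apply, Matrix.mul_apply,
      smul_eq_mul, h01, h11]
    ring
  have hβtr : ∀ a, ((g.diffMatrix f x).adjugate * β a).trace = 0 := by
    intro a
    simp only [hβ, Fin.sum_univ_two, Matrix.mul_add, Matrix.mul_smul, Matrix.trace_add,
      Matrix.trace_smul, htrace, smul_zero, add_zero]
  have hmin : ∀ k, ∑ a, ∑ b,
      (1 + (g.diffMatrix f x)ᵀ * g.diffMatrix f x).adjugate a b * β a k b = 0 := by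
    intro k
    set ξ : Fin 2 → Plane := fun m => g.coframe x *ᵥ e m with hξ
    have hon : ∀ i j, ξ i ⬝ᵥ ((1 + (g.diffMatrix f x)ᵀ * g.diffMatrix f x) *ᵥ ξ j)
        = if i = j then 1 else 0 := fun i j => by
      rw [← he i j, g.prodInner_graphTangent (hfx.differentiableAt (by simp))]
    simp only [← sum_mul_of_orthonormal hon]
    have htr := fun k => g.covDiff_trace hf.minimal hxΩ he k
    have heξ : ∀ m i, e m i = g.frame x i 0 * ξ m 0 + g.frame x i 1 * ξ m 1 := by
      intro m i
      have := congrFun (g.sum_frame_coframe x (e m)) i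
      simp only [Pi.add_apply, Pi.smul_apply, smul_eq_mul] at this
      rw [this]
      ring
    have hβe : ∑ m, ∑ a, ∑ b, ξ m a * ξ m b * β a k b
        = ∑ l, g.coframe (f x) k l * ∑ m, ∑ i, ∑ j, g.covDiff f i x l j * e m i * e m j := by
      simp only [heξ, hβ, hN, Fin.sum_univ_two, Matrix.add_apply, Matrix.smul_apply,
        Matrix.mul_apply, smul_eq_mul]
      ring
    simp only [htr, mul_zero, Finset.sum_const_zero] at hβe
    simp only [Fin.sum_univ_two] at hβe ⊢
    linear_combination (1 + (g.diffMatrix f x)ᵀ * g.diffMatrix f x).det * hβe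
  have hst := conformal_arg_stationary hdet hsymm hβtr hmin
  have hNi : (g.diffMatrix f x 0 0 + g.diffMatrix f x 1 1) * (N i 1 0 - N i 0 1)
      - (g.diffMatrix f x 1 0 - g.diffMatrix f x 0 1) * (N i 0 0 + N i 1 1) = 0 := by
    rw [hNβ i]
    simp only [Matrix.add_apply, Matrix.smul_apply, smul_eq_mul]
    linear_combination g.coframe x 0 i * hst 0 + g.coframe x 1 i * hst 1
  have hRe : pd i (g.confRe f) x = pd i (fun y => g.diffMatrix f y 0 0) x
      + pd i (fun y => g.diffMatrix f y 1 1) x := pd_add i (hF 0 0) (hF 1 1)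
  have hIm : pd i (g.confIm f) x = pd i (fun y => g.diffMatrix f y 1 0) x
      - pd i (fun y => g.diffMatrix f y 0 1) x := by
    change fderiv ℝ (fun y => g.diffMatrix f y 1 0 - g.diffMatrix f y 0 1) x _ = _
    rw [fderiv_fun_sub (hF 1 0) (hF 0 1)]
    rfl
  -- `N i` leaves the argument of the conformal part fixed. Multiplying `F` by `rotJ` on either side
  -- multiplies that part by the imaginary unit, so the connection terms contribute exactly their
  -- difference.
  rw [hRe, hIm, hD, hD, hD, hD, Metric.confRe, Metric.confIm, hJ00, hJ01, hJ10, hJ11]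
  linear_combination hNi

/-- Differentiating a unit vector in polar coordinates. -/
lemma fderiv_polar {c s r : Plane → ℝ} {x v : Plane} {A : ℝ} (hc : DifferentiableAt ℝ c x)
    (hs : DifferentiableAt ℝ s x) (hr : DifferentiableAt ℝ r x) (hr0 : r x ≠ 0)
    (hcs : (fun y => c y * c y + s y * s y) =ᶠ[𝓝 x] fun _ => 1)
    (h : c x * r x * fderiv ℝ (fun y => s y * r y) x v
      - s x * r x * fderiv ℝ (fun y => c y * r y) x v = A * r x ^ 2) :
    fderiv ℝ c x v = -s x * A ∧ fderiv ℝ s x v = c x * A := by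
  have h1 : c x * c x + s x * s x = 1 := hcs.eq_of_nhds
  have h2 := congrArg (fun l : Plane →L[ℝ] ℝ => l v) (hcs.fderiv_eq (𝕜 := ℝ))
  simp only [fderiv_fun_add (hc.fun_mul hc) (hs.fun_mul hs), fderiv_fun_mul hc hc,
    fderiv_fun_mul hs hs, _root_.add_apply, _root_.smul_apply,
    smul_eq_mul, fderiv_fun_const, Pi.zero_apply, _root_.zero_apply] at h2
  simp only [fderiv_fun_mul hs hr, fderiv_fun_mul hc hr, _root_.add_apply,
    _root_.smul_apply, smul_eq_mul] at h
  have h3 : c x * fderiv ℝ s x v - s x * fderiv ℝ c x v = A := by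
    refine mul_right_cancel₀ (pow_ne_zero 2 hr0) ?_
    linear_combination h
  constructor
  · linear_combination (c x / 2) * h2 - s x * h3 - fderiv ℝ c x v * h1
  · linear_combination (s x / 2) * h2 + c x * h3 - fderiv ℝ s x v * h1

lemma IsMinimalLagrangianDiffeo.fderiv_rot_interior {g : Metric} {f : Plane → Plane}
    {Ω Ω' : Set Plane} (hf : IsMinimalLagrangianDiffeo g f Ω Ω') {x : Plane}
    (hx : x ∈ interior Ω) (v : Plane) :
    fderiv ℝ (g.rotCos f) x v
      = -g.rotSin f x * (g.connForm x v - g.connForm (f x) (fderiv ℝ f x v)) ∧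
    fderiv ℝ (g.rotSin f) x v
      = g.rotCos f x * (g.connForm x v - g.connForm (f x) (fderiv ℝ f x v)) := by
  have hfx := hf.contDiffAt (interior_subset hx)
  have hdet : ∀ᶠ y in 𝓝 x, (g.diffMatrix f y).det = 1 := by
    filter_upwards [isOpen_interior.mem_nhds hx] with y hy using hf.det_diffMatrix_interior hy
  have hd := hdet.self_of_nhds
  refine fderiv_polar (r := g.confAbs f)
    ((Metric.contDiffAt_rotCos hfx hd).differentiableAt (by simp))
    ((Metric.contDiffAt_rotSin hfx hd).differentiableAt (by simp))
    ((Metric.contDiffAt_confAbs hfx hd).differentiableAt (by simp))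
    (Metric.confAbs_pos hd).ne' ?_ ?_
  · filter_upwards [hdet] with y hy
    have := Metric.rot_sq hy
    linarith
  · have e1 : (fun y => g.rotCos f y * g.confAbs f y) =ᶠ[𝓝 x] g.confRe f := by
      filter_upwards [hdet] with y hy using Metric.rotCos_mul hy
    have e2 : (fun y => g.rotSin f y * g.confAbs f y) =ᶠ[𝓝 x] g.confIm f := by
      filter_upwards [hdet] with y hy using Metric.rotSin_mul hy
    rw [e1.fderiv_eq, e2.fderiv_eq, Metric.rotCos_mul hd, Metric.rotSin_mul hd,
      Metric.confAbs_sq, fderiv_apply_eq_pd, fderiv_apply_eq_pd, clm_apply_eq (fderiv ℝ f x) v,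
      map_add, map_smul, map_smul, g.connForm_apply x v]
    have h0 := hf.pd_conf hx 0
    have h1 := hf.pd_conf hx 1
    simp only [smul_eq_mul]
    linear_combination v 0 * h0 + v 1 * h1

/-- The rotation in the polar decomposition of `Df` is parallel, up to the boundary. -/
lemma IsMinimalLagrangianDiffeo.fderiv_rot {g : Metric} {f : Plane → Plane}
    {Ω Ω' : Set Plane} (hf : IsMinimalLagrangianDiffeo g f Ω Ω')
    (hΩ : IsStrictlyConvexDomain g Ω) {x : Plane} (hx : x ∈ Ω) (v : Plane) :
    fderiv ℝ (g.rotCos f) x v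
      = -g.rotSin f x * (g.connForm x v - g.connForm (f x) (fderiv ℝ f x v)) ∧
    fderiv ℝ (g.rotSin f) x v
      = g.rotCos f x * (g.connForm x v - g.connForm (f x) (fderiv ℝ f x v)) := by
  have hfx := hf.contDiffAt hx
  have hd := hf.det_diffMatrix hΩ hx
  have hc := Metric.contDiffAt_rotCos hfx hd
  have hs := Metric.contDiffAt_rotSin hfx hd
  have hD : ∀ {F : Type} [NormedAddCommGroup F] [NormedSpace ℝ F] {φ : Plane → F},
      ContDiffAt ℝ ∞ φ x → ContinuousAt (fun y => fderiv ℝ φ y v) x := fun h =>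
    ((h.fderiv_right (m := ∞) (by simp)).clm_apply contDiffAt_const).continuousAt
  have hA : ContinuousAt (fun y => g.connForm y v - g.connForm (f y) (fderiv ℝ f y v)) x := by
    refine ContinuousAt.sub ?_ ?_
    · exact (g.contDiff_connForm.continuous.clm_apply continuous_const).continuousAt
    · exact (g.contDiff_connForm.continuous.continuousAt.comp hfx.continuousAt).clm_apply (hD hfx)
  exact ⟨hΩ.eq_of_eqOn_interior (φ := fun y => fderiv ℝ (g.rotCos f) y v)
      (ψ := fun y => -g.rotSin f y * (g.connForm y v - g.connForm (f y) (fderiv ℝ f y v)))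
      hx (hD hc) (hs.continuousAt.neg.mul hA) fun y hy => (hf.fderiv_rot_interior hy v).1,
    hΩ.eq_of_eqOn_interior (φ := fun y => fderiv ℝ (g.rotSin f) y v)
      (ψ := fun y => g.rotCos f y * (g.connForm y v - g.connForm (f y) (fderiv ℝ f y v)))
      hx (hD hs) (hc.continuousAt.mul hA) fun y hy => (hf.fderiv_rot_interior hy v).2⟩

/-! ### The chain rule for `lap` -/

section lap

variable {E F : Type*} [NormedAddCommGroup E] [NormedSpace ℝ E] [NormedAddCommGroup F]
  [NormedSpace ℝ F]

lemma ContDiffAt.eventually_differentiableAt {φ : E → F} {x : E} (h : ContDiffAt ℝ ∞ φ x) :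
    ∀ᶠ y in 𝓝 x, DifferentiableAt ℝ φ y := by
  filter_upwards [(h.of_le (m := 1) (by simp)).eventually (by simp)] with y hy
  exact hy.differentiableAt (by simp)

lemma fderiv_fderiv_comp {X : Plane → E} {Φ : E → F} {x : Plane} (hX : ContDiffAt ℝ ∞ X x)
    (hΦ : ContDiffAt ℝ ∞ Φ (X x)) (v : Plane) :
    fderiv ℝ (fun y => fderiv ℝ (fun y => Φ (X y)) y v) x v
      = fderiv ℝ (fderiv ℝ Φ) (X x) (fderiv ℝ X x v) (fderiv ℝ X x v)
        + fderiv ℝ Φ (X x) (fderiv ℝ (fun y => fderiv ℝ X y v) x v) := by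
  have h1 : (fun y => fderiv ℝ (fun y => Φ (X y)) y v)
      =ᶠ[𝓝 x] fun y => fderiv ℝ Φ (X y) (fderiv ℝ X y v) := by
    filter_upwards [ContDiffAt.eventually_differentiableAt hX, hX.continuousAt.eventually
      (ContDiffAt.eventually_differentiableAt hΦ)] with y hy hy'
    have : fderiv ℝ (fun y => Φ (X y)) y = fderiv ℝ Φ (X y) ∘L fderiv ℝ X y :=
      fderiv_comp y hy' hy
    rw [this]
    rfl
  have hDX : DifferentiableAt ℝ (fun y => fderiv ℝ X y v) x :=
    ((hX.fderiv_right (m := ∞) (by simp)).clm_apply contDiffAt_const).differentiableAt (by simp)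
  have hDΦ : DifferentiableAt ℝ (fderiv ℝ Φ) (X x) :=
    (hΦ.fderiv_right (m := ∞) (by simp)).differentiableAt (by simp)
  have hXd : DifferentiableAt ℝ X x := hX.differentiableAt (by simp)
  have hcomp : fderiv ℝ (fun y => fderiv ℝ Φ (X y)) x
      = fderiv ℝ (fderiv ℝ Φ) (X x) ∘L fderiv ℝ X x := fderiv_comp x hDΦ hXd
  have hdc : DifferentiableAt ℝ (fun y => fderiv ℝ Φ (X y)) x := hDΦ.comp x hXd
  rw [h1.fderiv_eq, fderiv_clm_apply hdc hDX, hcomp]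
  simp [add_comm]

/-- `lap` of a composite involves `X` only through `DX(eₘ)` and `lap X`. These are the two
quantities that can be bounded uniformly. -/
lemma lap_comp {X : Plane → E} {Φ : E → F} {x : Plane} (hX : ContDiffAt ℝ ∞ X x)
    (hΦ : ContDiffAt ℝ ∞ Φ (X x)) (e : Fin 2 → Plane) (b : Plane) :
    lap e b (fun y => Φ (X y)) x
      = ∑ m, fderiv ℝ (fderiv ℝ Φ) (X x) (fderiv ℝ X x (e m)) (fderiv ℝ X x (e m))
        + fderiv ℝ Φ (X x) (lap e b X x) := by
  have h : fderiv ℝ (fun y => Φ (X y)) x = fderiv ℝ Φ (X x) ∘L fderiv ℝ X x :=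
    fderiv_comp x (hΦ.differentiableAt (by simp)) (hX.differentiableAt (by simp))
  simp only [lap, fderiv_fderiv_comp hX hΦ, h, Finset.sum_add_distrib, map_sub, map_sum,
    ContinuousLinearMap.comp_apply]
  abel

lemma lap_clm {X : Plane → E} {x : Plane} (hX : ContDiffAt ℝ ∞ X x) (L : E →L[ℝ] F)
    (e : Fin 2 → Plane) (b : Plane) :
    lap e b (fun y => L (X y)) x = L (lap e b X x) := by
  have h : fderiv ℝ (fun z : E => L z) = fun _ => L := funext fun z => L.fderiv
  rw [lap_comp (Φ := fun z => L z) hX L.contDiff.contDiffAt, h]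
  simp

lemma lap_prodMk {φ : Plane → E} {ψ : Plane → F} {x : Plane} (hφ : ContDiffAt ℝ ∞ φ x)
    (hψ : ContDiffAt ℝ ∞ ψ x) (e : Fin 2 → Plane) (b : Plane) :
    lap e b (fun y => (φ y, ψ y)) x = (lap e b φ x, lap e b ψ x) :=
  Prod.ext (lap_clm (hφ.prodMk hψ) (.fst ℝ E F) e b).symm
    (lap_clm (hφ.prodMk hψ) (.snd ℝ E F) e b).symm

lemma lap_sub_const_mul {φ ψ : Plane → ℝ} {x : Plane} (hφ : ContDiffAt ℝ ∞ φ x)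
    (hψ : ContDiffAt ℝ ∞ ψ x) (k : ℝ) (e : Fin 2 → Plane) (b : Plane) :
    lap e b (fun y => φ y - k * ψ y) x = lap e b φ x - k * lap e b ψ x := by
  have := lap_clm (hφ.prodMk hψ)
    (ContinuousLinearMap.fst ℝ ℝ ℝ - k • ContinuousLinearMap.snd ℝ ℝ ℝ) e b
  rw [lap_prodMk hφ hψ] at this
  simpa using this

end lap

lemma lap_id (e : Fin 2 → Plane) (b x : Plane) : lap e b (fun y => y) x = -b := by
  simp [lap]

/-! ### Adapted bases of the tangent space of the graph -/

/-- `e` projects an orthonormal basis of the tangent space of the graph of `f` at `x`. -/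
def Metric.IsAdapted (g : Metric) (f : Plane → Plane) (x : Plane) (e : Fin 2 → Plane) : Prop :=
  ∀ i j, g.prodInner x (f x) (graphTangent f x (e i)) (graphTangent f x (e j))
    = if i = j then 1 else 0

/-- The first order term of the Laplacian of the graph. -/
def Metric.drift (g : Metric) (x : Plane) (e : Fin 2 → Plane) : Plane :=
  ∑ m, g.gamma x (e m) (e m)

lemma Metric.inner_self_nonneg (g : Metric) (x v : Plane) : 0 ≤ g.inner x v v := by
  rw [g.inner_eq]
  simp only [dotProduct, Fin.sum_univ_two]
  exact add_nonneg (mul_self_nonneg _) (mul_self_nonneg _)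

section adapted

variable {g : Metric} {f : Plane → Plane} {x : Plane} {e : Fin 2 → Plane}

/-- A unit tangent vector of the graph splits between the two factors. Thus `eₘ` and `Df eₘ` both
have length at most 1 with no bound on `Df`, the source of all uniformity in `f`. -/
lemma Metric.IsAdapted.inner_add (he : g.IsAdapted f x e) (hf : DifferentiableAt ℝ f x)
    (m : Fin 2) :
    g.inner x (e m) (e m) + g.inner (f x) (fderiv ℝ f x (e m)) (fderiv ℝ f x (e m)) = 1 := by
  have := he m m
  simpa [Metric.prodInner, graphTangent, jac_mulVec hf] using this

lemma Metric.IsAdapted.inner_le (he : g.IsAdapted f x e) (hf : DifferentiableAt ℝ f x)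
    (m : Fin 2) : g.inner x (e m) (e m) ≤ 1 := by
  linarith [he.inner_add hf m,
    g.inner_self_nonneg (f x) (fderiv ℝ f x (e m))]

lemma Metric.IsAdapted.inner_map_le (he : g.IsAdapted f x e) (hf : DifferentiableAt ℝ f x)
    (m : Fin 2) : g.inner (f x) (fderiv ℝ f x (e m)) (fderiv ℝ f x (e m)) ≤ 1 := by
  linarith [he.inner_add hf m, g.inner_self_nonneg x (e m)]

/-- The sum is the trace of `M⁻¹` for `M = 1 + FᵀF`, that is `tr M / det M`, and both are `2 + |F|²`
when `det F = 1`. -/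
lemma Metric.IsAdapted.sum_inner (he : g.IsAdapted f x e) (hf : DifferentiableAt ℝ f x)
    (hdet : (g.diffMatrix f x).det = 1) : ∑ m, g.inner x (e m) (e m) = 1 := by
  set M := 1 + (g.diffMatrix f x)ᵀ * g.diffMatrix f x with hM
  have hon : ∀ i j, (g.coframe x *ᵥ e i) ⬝ᵥ (M *ᵥ (g.coframe x *ᵥ e j))
      = if i = j then 1 else 0 := fun i j => by
    rw [← he i j, g.prodInner_graphTangent hf]
  have h00 := sum_mul_of_orthonormal (ξ := fun m => g.coframe x *ᵥ e m) hon 0 0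
  have h11 := sum_mul_of_orthonormal (ξ := fun m => g.coframe x *ᵥ e m) hon 1 1
  have hMdet : M.det = M.adjugate 0 0 + M.adjugate 1 1 := by
    have h1 := Metric.det_one_add_eq hdet
    rw [Metric.confAbs_sq, Metric.conf_sq_eq hdet] at h1
    rw [h1, hM]
    simp [Matrix.adjugate_fin_two, Matrix.mul_apply, Fin.sum_univ_two]
    ring
  have hpos : 0 < M.det := by
    rw [Metric.det_one_add_eq hdet]
    have := Metric.confAbs_pos hdet
    positivity
  refine mul_left_cancel₀ hpos.ne' ?_
  simp only [g.inner_eq, dotProduct, Fin.sum_univ_two] at h00 h11 ⊢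
  linear_combination h00 + h11 - hMdet

lemma Metric.IsAdapted.sum_inner_map (he : g.IsAdapted f x e) (hf : DifferentiableAt ℝ f x)
    (hdet : (g.diffMatrix f x).det = 1) :
    ∑ m, g.inner (f x) (fderiv ℝ f x (e m)) (fderiv ℝ f x (e m)) = 1 := by
  have h := he.sum_inner hf hdet
  have h0 := he.inner_add hf 0
  have h1 := he.inner_add hf 1
  simp only [Fin.sum_univ_two] at h ⊢
  linarith

/-- Minimality: the map `f` is harmonic with respect to the metric of the graph. -/
lemma Metric.IsAdapted.lap_map (he : g.IsAdapted f x e) {Ω : Set Plane}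
    (hmin : g.IsMinimalGraph f Ω) (hx : x ∈ Ω) (hf : ContDiffAt ℝ ∞ f x) :
    lap e (g.drift x e) f x
      = -∑ m, g.gamma (f x) (fderiv ℝ f x (e m)) (fderiv ℝ f x (e m)) := by
  have hfd : DifferentiableAt ℝ f x := hf.differentiableAt (by simp)
  ext k
  have h := congrFun (hmin.graphNabla_eq hx he) k
  have h1 := (lap_clm hf (ContinuousLinearMap.proj (R := ℝ) (φ := fun _ : Fin 2 => ℝ) k) e
    (g.drift x e)).symm
  simp only [ContinuousLinearMap.proj_apply] at h1
  rw [h1, lap]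
  have h2 : fderiv ℝ (fun y => f y k) x (g.drift x e) = (jac f x *ᵥ g.drift x e) k := by
    rw [fderiv_apply_eq_pd]
    simp only [Matrix.mulVec, dotProduct, Fin.sum_univ_two, jac]
    ring
  rw [h2]
  simp only [fderiv_fderiv_eq_pd (contDiffAt_pi.1 hf k)]
  have h3 : g.drift x e = (∑ i, g.graphNabla f x (e i) (e i)).1 := by
    simp [Metric.drift, Metric.graphNabla, Fin.sum_univ_two]
  rw [h3, ← h]
  simp only [Metric.graphNabla, jac_mulVec hfd, Fin.sum_univ_two, Prod.snd_add, Pi.add_apply,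
    Pi.neg_apply]
  ring

/-- Harmonicity of `f` supplies exactly the Christoffel term that completes `D²h` to the Hessian on
the target. -/
lemma Metric.IsAdapted.lap_comp_map (he : g.IsAdapted f x e) {Ω : Set Plane}
    (hmin : g.IsMinimalGraph f Ω) (hx : x ∈ Ω) (hf : ContDiffAt ℝ ∞ f x) {h : Plane → ℝ}
    (hh : ContDiffAt ℝ ∞ h (f x)) :
    lap e (g.drift x e) (fun y => h (f y)) x
      = ∑ m, g.hess h (f x) (fderiv ℝ f x (e m)) (fderiv ℝ f x (e m)) := by
  rw [lap_comp hf hh, he.lap_map hmin hx hf]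
  simp only [g.hess_eq hh, fderiv_fderiv_apply hh, Fin.sum_univ_two, map_neg, map_add]
  ring

end adapted

/-! ### Uniform bounds -/

/-- A bound for the geometry over a set: the frame, the Christoffel symbols and the connection
form. -/
structure Metric.GeomBound (g : Metric) (K : Set Plane) (r : ℝ) : Prop where
  pos : 0 ≤ r
  vec : ∀ x ∈ K, ∀ v, g.inner x v v ≤ 1 → ‖v‖ ≤ r
  gamma : ∀ x ∈ K, ∀ v, g.inner x v v ≤ 1 → ‖g.gamma x v v‖ ≤ r
  conn : ∀ x ∈ K, ‖g.connForm x‖ ≤ r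
  dconn : ∀ x ∈ K, ‖fderiv ℝ g.connForm x‖ ≤ r

lemma Metric.exists_geomBound (g : Metric) {K : Set Plane} (hK : IsCompact K) :
    ∃ r, g.GeomBound K r := by
  have hK' : IsCompact (K ×ˢ Metric.closedBall (0 : Plane) 1) :=
    hK.prod (isCompact_closedBall _ _)
  have hframe : Continuous (fun p : Plane × Plane => g.frame p.1 *ᵥ p.2) := by
    refine continuous_pi fun k => ?_
    simp only [Matrix.mulVec, dotProduct, Fin.sum_univ_two]
    have := fun a b => (g.contDiff_frame a b).continuous
    fun_prop
  have hgamma : Continuous (fun p : Plane × Plane => g.gamma p.1 p.2 p.2) := by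
    refine continuous_pi fun k => ?_
    simp only [Metric.gamma, Fin.sum_univ_two]
    have := fun k i j => (g.contDiff_christoffel k i j).continuous
    fun_prop
  have hgamma' : Continuous (fun p : Plane × Plane =>
      g.gamma p.1 (g.frame p.1 *ᵥ p.2) (g.frame p.1 *ᵥ p.2)) :=
    hgamma.comp (continuous_fst.prodMk hframe)
  obtain ⟨r₁, h₁⟩ := hK'.exists_bound_of_continuousOn hframe.continuousOn
  obtain ⟨r₂, h₂⟩ := hK'.exists_bound_of_continuousOn hgamma'.continuousOn
  obtain ⟨r₃, h₃⟩ := hK.exists_bound_of_continuousOn g.contDiff_connForm.continuous.continuousOn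
  obtain ⟨r₄, h₄⟩ := hK.exists_bound_of_continuousOn
    (g.contDiff_connForm.continuous_fderiv (by simp)).continuousOn
  -- Vectors of length at most 1 have frame components in the closed unit ball of the sup norm, so
  -- all bounds come from continuity on `K` times a compact ball.
  have hball : ∀ x v, g.inner x v v ≤ 1 → ∃ ξ ∈ Metric.closedBall (0 : Plane) 1,
      v = g.frame x *ᵥ ξ := by
    intro x v hv
    refine ⟨g.coframe x *ᵥ v, ?_, ?_⟩
    · rw [g.inner_eq] at hv
      simp only [dotProduct, Fin.sum_univ_two] at hv
      rw [mem_closedBall_zero_iff, pi_norm_le_iff_of_nonneg zero_le_one]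
      intro i
      rw [Real.norm_eq_abs, abs_le_one_iff_mul_self_le_one]
      obtain rfl | rfl : i = 0 ∨ i = 1 := by omega
      · nlinarith [mul_self_nonneg ((g.coframe x *ᵥ v) 1)]
      · nlinarith [mul_self_nonneg ((g.coframe x *ᵥ v) 0)]
    · rw [Matrix.mulVec_mulVec, g.frame_mul_coframe, Matrix.one_mulVec]
  refine ⟨max (max (max r₁ r₂) (max r₃ r₄)) 0, le_max_right _ _, ?_, ?_, ?_, ?_⟩
  · intro x hx v hv
    obtain ⟨ξ, hξ, rfl⟩ := hball x v hv
    exact (h₁ (x, ξ) ⟨hx, hξ⟩).trans (by simp)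
  · intro x hx v hv
    obtain ⟨ξ, hξ, rfl⟩ := hball x v hv
    exact (h₂ (x, ξ) ⟨hx, hξ⟩).trans (by simp)
  · exact fun x hx => (h₃ x hx).trans (by simp)
  · exact fun x hx => (h₄ x hx).trans (by simp)

/-- The combined position, image and rotation of `f`. -/
def Metric.gaussMap (g : Metric) (f : Plane → Plane) (x : Plane) : Plane × Plane × ℝ × ℝ :=
  (x, f x, g.rotCos f x, g.rotSin f x)

/-- `lap` of a function with `Dφ = ψ (α - f^*α)`. -/
lemma lap_of_fderiv_eq {g : Metric} {f : Plane → Plane} {φ ψ : Plane → ℝ} {x : Plane}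
    (hf : ContDiffAt ℝ ∞ f x) (hψ : DifferentiableAt ℝ ψ x)
    (h : ∀ᶠ y in 𝓝 x, ∀ v, fderiv ℝ φ y v
      = ψ y * (g.connForm y v - g.connForm (f y) (fderiv ℝ f y v)))
    (e : Fin 2 → Plane) (b : Plane) :
    lap e b φ x
      = ∑ m, fderiv ℝ ψ x (e m) * (g.connForm x (e m) - g.connForm (f x) (fderiv ℝ f x (e m)))
        + ψ x * (∑ m, (fderiv ℝ g.connForm x (e m) (e m)
          - fderiv ℝ g.connForm (f x) (fderiv ℝ f x (e m)) (fderiv ℝ f x (e m)))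
          - g.connForm x b - g.connForm (f x) (lap e b f x)) := by
  have hα : ∀ y, DifferentiableAt ℝ g.connForm y := fun y =>
    g.contDiff_connForm.contDiffAt.differentiableAt (by simp)
  have hfd : DifferentiableAt ℝ f x := hf.differentiableAt (by simp)
  -- The second derivatives of `f` enter linearly and undifferentiated, so after the trace they
  -- survive only as `lap f`, which harmonicity controls.
  have key : ∀ v, fderiv ℝ (fun y => fderiv ℝ φ y v) x v
      = fderiv ℝ ψ x v * (g.connForm x v - g.connForm (f x) (fderiv ℝ f x v))
        + ψ x * (fderiv ℝ g.connForm x v v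
          - fderiv ℝ g.connForm (f x) (fderiv ℝ f x v) (fderiv ℝ f x v)
          - g.connForm (f x) (fderiv ℝ (fun y => fderiv ℝ f y v) x v)) := by
    intro v
    have h1 : (fun y => fderiv ℝ φ y v) =ᶠ[𝓝 x]
        fun y => ψ y * (g.connForm y v - g.connForm (f y) (fderiv ℝ f y v)) := by
      filter_upwards [h] with y hy using hy v
    have hDf : DifferentiableAt ℝ (fun y => fderiv ℝ f y v) x :=
      ((hf.fderiv_right (m := ∞) (by simp)).clm_apply contDiffAt_const).differentiableAt (by simp)
    have hαf : DifferentiableAt ℝ (fun y => g.connForm (f y)) x := (hα (f x)).comp x hfd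
    have hαfd : fderiv ℝ (fun y => g.connForm (f y)) x
        = fderiv ℝ g.connForm (f x) ∘L fderiv ℝ f x := fderiv_comp x (hα (f x)) hfd
    have d1 : DifferentiableAt ℝ (fun y => g.connForm y v) x := (hα x).clm_apply (by fun_prop)
    have d2 : DifferentiableAt ℝ (fun y => g.connForm (f y) (fderiv ℝ f y v)) x :=
      hαf.clm_apply hDf
    rw [h1.fderiv_eq, fderiv_fun_mul hψ (d1.fun_sub d2), fderiv_fun_sub d1 d2,
      fderiv_clm_apply (hα x) (by fun_prop), fderiv_clm_apply hαf hDf, hαfd]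
    simp
    ring
  have hb := h.self_of_nhds b
  simp only [lap, key, hb, Fin.sum_univ_two, map_add, map_sub]
  ring

section bounds

variable {g : Metric} {f : Plane → Plane} {Ω Ω' : Set Plane} {x : Plane} {r : ℝ}

lemma Metric.GeomBound.abs_conn_le (hr : g.GeomBound (Ω ∪ Ω') r) {y u w : Plane} (hx : x ∈ Ω)
    (hy : y ∈ Ω') (hu : ‖u‖ ≤ r) (hw : ‖w‖ ≤ r) :
    |g.connForm x u - g.connForm y w| ≤ 2 * r ^ 2 := by
  have h1 := (g.connForm x).le_of_opNorm_le_of_le (hr.conn x (.inl hx)) hu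
  have h2 := (g.connForm y).le_of_opNorm_le_of_le (hr.conn y (.inr hy)) hw
  rw [Real.norm_eq_abs, abs_le] at h1 h2
  rw [abs_le]
  constructor <;> nlinarith

lemma Metric.GeomBound.abs_dconn_le (hr : g.GeomBound (Ω ∪ Ω') r) {y u : Plane}
    (hy : y ∈ Ω ∪ Ω') (hu : ‖u‖ ≤ r) : |fderiv ℝ g.connForm y u u| ≤ r ^ 3 := by
  have h1 := (fderiv ℝ g.connForm y).le_of_opNorm_le_of_le (hr.dconn y hy) hu
  have h2 := (fderiv ℝ g.connForm y u).le_of_opNorm_le_of_le h1 hu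
  rw [Real.norm_eq_abs] at h2
  calc _ ≤ _ := h2
    _ = r ^ 3 := by ring

lemma norm_sum_two_le {v : Fin 2 → Plane} (h : ∀ m, ‖v m‖ ≤ r) : ‖∑ m, v m‖ ≤ 2 * r := by
  rw [Fin.sum_univ_two]
  linarith [norm_add_le (v 0) (v 1), h 0, h 1]

lemma abs_add_mul_le {A c : ℝ} {T U : Fin 2 → ℝ} {p q : ℝ} {ρ σ τ : ℝ} (hA : A = ∑ m, T m + c *
    (∑ m, U m - p - q)) (hT : ∀ m, |T m| ≤ ρ) (hc : |c| ≤ 1) (hU : ∀ m, |U m| ≤ σ)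
    (hp : |p| ≤ τ) (hq : |q| ≤ τ) : |A| ≤ 2 * ρ + (2 * σ + 2 * τ) := by
  have h1 : |∑ m, U m - p - q| ≤ 2 * σ + 2 * τ := by
    have h0 := hU 0
    have h1 := hU 1
    rw [abs_le] at *
    rw [Fin.sum_univ_two]
    constructor <;> linarith
  have h2 : |c * (∑ m, U m - p - q)| ≤ 2 * σ + 2 * τ := by
    rw [abs_mul]
    calc |c| * |∑ m, U m - p - q| ≤ 1 * |∑ m, U m - p - q| := by gcongr
      _ ≤ _ := by rw [one_mul]; exact h1
  rw [hA]
  refine (abs_add_le _ _).trans (add_le_add ?_ h2)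
  have h0 := hT 0
  have h1 := hT 1
  rw [abs_le] at *
  rw [Fin.sum_univ_two]
  constructor <;> linarith

lemma Metric.abs_rotCos_le (hdet : (g.diffMatrix f x).det = 1) : |g.rotCos f x| ≤ 1 := by
  have := Metric.rot_sq hdet
  rw [abs_le_one_iff_mul_self_le_one]
  nlinarith [sq_nonneg (g.rotSin f x)]

lemma Metric.abs_rotSin_le (hdet : (g.diffMatrix f x).det = 1) : |g.rotSin f x| ≤ 1 := by
  have := Metric.rot_sq hdet
  rw [abs_le_one_iff_mul_self_le_one]
  nlinarith [sq_nonneg (g.rotCos f x)]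

lemma IsMinimalLagrangianDiffeo.contDiffAt_gaussMap
    (hf : IsMinimalLagrangianDiffeo g f Ω Ω') (hΩ : IsStrictlyConvexDomain g Ω) (hx : x ∈ Ω) :
    ContDiffAt ℝ ∞ (g.gaussMap f) x :=
  contDiffAt_id.prodMk ((hf.contDiffAt hx).prodMk
    ((Metric.contDiffAt_rotCos (hf.contDiffAt hx) (hf.det_diffMatrix hΩ hx)).prodMk
      (Metric.contDiffAt_rotSin (hf.contDiffAt hx) (hf.det_diffMatrix hΩ hx))))

/-- First and second order bounds, independent of `f`, for the map `gaussMap`. -/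
lemma IsMinimalLagrangianDiffeo.gaussMap_bounds
    (hf : IsMinimalLagrangianDiffeo g f Ω Ω') (hΩ : IsStrictlyConvexDomain g Ω)
    (hr : g.GeomBound (Ω ∪ Ω') r) (hx : x ∈ interior Ω) {e : Fin 2 → Plane}
    (he : g.IsAdapted f x e) :
    (∀ m, ‖fderiv ℝ (g.gaussMap f) x (e m)‖ ≤ r + 2 * r ^ 2) ∧
    ‖lap e (g.drift x e) (g.gaussMap f) x‖ ≤ 2 * r + (8 * r ^ 4 + (4 * r ^ 3 + 4 * r ^ 2)) := by
  have hxΩ := interior_subset hx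
  have hfx := hf.contDiffAt hxΩ
  have hfd : DifferentiableAt ℝ f x := hfx.differentiableAt (by simp)
  have hdet := hf.det_diffMatrix hΩ hxΩ
  have hfΩ := hf.mapsTo hxΩ
  have hc := Metric.contDiffAt_rotCos hfx hdet
  have hs := Metric.contDiffAt_rotSin hfx hdet
  have hcd : DifferentiableAt ℝ (g.rotCos f) x := hc.differentiableAt (by simp)
  have hsd : DifferentiableAt ℝ (g.rotSin f) x := hs.differentiableAt (by simp)
  have hr0 := hr.pos
  have hu : ∀ m, ‖e m‖ ≤ r := fun m => hr.vec x (.inl hxΩ) _ (he.inner_le hfd m)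
  have hw : ∀ m, ‖fderiv ℝ f x (e m)‖ ≤ r := fun m =>
    hr.vec (f x) (.inr hfΩ) _ (he.inner_map_le hfd m)
  have hA : ∀ m, |g.connForm x (e m) - g.connForm (f x) (fderiv ℝ f x (e m))| ≤ 2 * r ^ 2 :=
    fun m => hr.abs_conn_le hxΩ hfΩ (hu m) (hw m)
  have hrot := hf.fderiv_rot hΩ hxΩ
  have hCos : ∀ m, |fderiv ℝ (g.rotCos f) x (e m)| ≤ 2 * r ^ 2 := fun m => by
    rw [(hrot (e m)).1, abs_mul, abs_neg]
    exact (mul_le_of_le_one_left (abs_nonneg _) (Metric.abs_rotSin_le hdet)).trans (hA m)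
  have hSin : ∀ m, |fderiv ℝ (g.rotSin f) x (e m)| ≤ 2 * r ^ 2 := fun m => by
    rw [(hrot (e m)).2, abs_mul]
    exact (mul_le_of_le_one_left (abs_nonneg _) (Metric.abs_rotCos_le hdet)).trans (hA m)
  have hdrift : ‖g.drift x e‖ ≤ 2 * r :=
    norm_sum_two_le fun m => hr.gamma x (.inl hxΩ) _ (he.inner_le hfd m)
  have hlapf : ‖lap e (g.drift x e) f x‖ ≤ 2 * r := by
    rw [he.lap_map hf.minimal hxΩ hfx, norm_neg]
    exact norm_sum_two_le fun m => hr.gamma (f x) (.inr hfΩ) _ (he.inner_map_le hfd m)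
  have hT : ∀ {ψ : Plane → ℝ} m, |fderiv ℝ ψ x (e m)| ≤ 2 * r ^ 2 →
      |fderiv ℝ ψ x (e m) * (g.connForm x (e m) - g.connForm (f x) (fderiv ℝ f x (e m)))|
        ≤ 4 * r ^ 4 := fun m h => by
    rw [abs_mul]
    calc _ ≤ 2 * r ^ 2 * (2 * r ^ 2) := mul_le_mul h (hA m) (abs_nonneg _) (by positivity)
      _ = 4 * r ^ 4 := by ring
  have hU : ∀ m, |fderiv ℝ g.connForm x (e m) (e m)
      - fderiv ℝ g.connForm (f x) (fderiv ℝ f x (e m)) (fderiv ℝ f x (e m))| ≤ 2 * r ^ 3 :=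
    fun m => by
      have h1 := hr.abs_dconn_le (.inl hxΩ) (hu m)
      have h2 := hr.abs_dconn_le (.inr hfΩ) (hw m)
      rw [abs_le] at *
      constructor <;> linarith
  have hp : |g.connForm x (g.drift x e)| ≤ 2 * r ^ 2 := by
    have := (g.connForm x).le_of_opNorm_le_of_le (hr.conn x (.inl hxΩ)) hdrift
    rw [Real.norm_eq_abs] at this
    linarith
  have hq : |g.connForm (f x) (lap e (g.drift x e) f x)| ≤ 2 * r ^ 2 := by
    have := (g.connForm (f x)).le_of_opNorm_le_of_le (hr.conn (f x) (.inr hfΩ)) hlapf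
    rw [Real.norm_eq_abs] at this
    linarith
  have hnhds : ∀ᶠ y in 𝓝 x, y ∈ interior Ω := isOpen_interior.mem_nhds hx
  -- The formula is used for the pairs `(rotCos, -rotSin)` and `(rotSin, rotCos)`.
  have hlapc := lap_of_fderiv_eq hfx hsd.fun_neg (by
    filter_upwards [hnhds] with y hy v using (hf.fderiv_rot_interior hy v).1) e (g.drift x e)
  have hlaps := lap_of_fderiv_eq hfx hcd (by
    filter_upwards [hnhds] with y hy v using (hf.fderiv_rot_interior hy v).2) e (g.drift x e)
  have hc_le := abs_add_mul_le hlapc (fun m => hT m (by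
    rw [fderiv_fun_neg, _root_.neg_apply, abs_neg]; exact hSin m))
    (by rw [abs_neg]; exact Metric.abs_rotSin_le hdet) hU hp hq
  have hs_le := abs_add_mul_le hlaps (fun m => hT m (hCos m)) (Metric.abs_rotCos_le hdet) hU hp hq
  have hpos3 : 0 ≤ r ^ 3 := by positivity
  have hpos4 : 0 ≤ r ^ 4 := by positivity
  have hpos2 : 0 ≤ r ^ 2 := by positivity
  constructor
  · intro m
    have hD : fderiv ℝ (g.gaussMap f) x (e m) = (e m, fderiv ℝ f x (e m),
        fderiv ℝ (g.rotCos f) x (e m), fderiv ℝ (g.rotSin f) x (e m)) := by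
      have := (hasFDerivAt_id x).prodMk (hfd.hasFDerivAt.prodMk
        (hcd.hasFDerivAt.prodMk hsd.hasFDerivAt))
      have h2 : fderiv ℝ (g.gaussMap f) x = _ := this.fderiv
      rw [h2]
      rfl
    rw [hD, norm_prod_le_iff, norm_prod_le_iff, norm_prod_le_iff]
    have := hu m
    have := hw m
    have := hCos m
    have := hSin m
    simp only [Real.norm_eq_abs]
    refine ⟨?_, ?_, ?_, ?_⟩ <;> linarith
  · have hL : lap e (g.drift x e) (g.gaussMap f) x = (lap e (g.drift x e) (fun y => y) x,
        lap e (g.drift x e) f x, lap e (g.drift x e) (g.rotCos f) x,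
        lap e (g.drift x e) (g.rotSin f) x) := by
      have h1 := lap_prodMk hc hs e (g.drift x e)
      have h2 := lap_prodMk hfx (hc.prodMk hs) e (g.drift x e)
      have h3 := lap_prodMk contDiffAt_id (hfx.prodMk (hc.prodMk hs)) e (g.drift x e)
      rw [h2, h1] at h3
      exact h3
    rw [hL, lap_id, norm_prod_le_iff, norm_prod_le_iff, norm_prod_le_iff, norm_neg]
    simp only [Real.norm_eq_abs]
    refine ⟨?_, ?_, ?_, ?_⟩ <;> linarith

/-- A smooth function of position, image and rotation has a bounded Laplacian on the graph,
uniformly in the minimal Lagrangian diffeomorphism. -/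
lemma exists_lap_bound (hΩ : IsStrictlyConvexDomain g Ω) (hΩ' : IsCompact Ω')
    {Φ : Plane × Plane × ℝ × ℝ → ℝ}
    (hΦ : ∀ x ∈ Ω, ∀ y ∈ Ω', ∀ c s : ℝ, ContDiffAt ℝ ∞ Φ (x, y, c, s)) :
    ∃ C : ℝ, ∀ f, IsMinimalLagrangianDiffeo g f Ω Ω' → ∀ x ∈ interior Ω, ∀ e,
      g.IsAdapted f x e → lap e (g.drift x e) (fun y => Φ (g.gaussMap f y)) x ≤ C := by
  obtain ⟨r, hr⟩ := g.exists_geomBound (hΩ.compact.union hΩ')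
  -- Position, image and rotation stay in this compact set for every `f`, so the derivative bounds
  -- for `Φ` do not depend on `f`.
  set K : Set (Plane × Plane × ℝ × ℝ) :=
    Ω ×ˢ Ω' ×ˢ Set.Icc (-1 : ℝ) 1 ×ˢ Set.Icc (-1 : ℝ) 1 with hK
  have hKc : IsCompact K := hΩ.compact.prod (hΩ'.prod (isCompact_Icc.prod isCompact_Icc))
  have hΦK : ∀ z ∈ K, ContDiffAt ℝ ∞ Φ z := fun z hz => hΦ z.1 hz.1 z.2.1 hz.2.1 _ _
  obtain ⟨M₁, hM₁⟩ := hKc.exists_bound_of_continuousOn (f := fderiv ℝ Φ) fun z hz =>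
    ((hΦK z hz).fderiv_right (m := ∞) (by simp)).continuousAt.continuousWithinAt
  obtain ⟨M₂, hM₂⟩ := hKc.exists_bound_of_continuousOn (f := fderiv ℝ (fderiv ℝ Φ)) fun z hz =>
    (((hΦK z hz).fderiv_right (m := ∞) (by simp)).fderiv_right
      (m := ∞) (by simp)).continuousAt.continuousWithinAt
  -- `R` covers `r` (position, image) and `2r²` (rotation). `R'` adds the bound `2r` for position
  -- and image to `2·4r⁴ + 2·2r³ + 2·2r²` for the rotation, from the products of first derivatives,
  -- the derivatives of the connection form, and the first order terms.
  set R := r + 2 * r ^ 2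
  set R' := 2 * r + (8 * r ^ 4 + (4 * r ^ 3 + 4 * r ^ 2))
  refine ⟨2 * (M₂ * R * R) + M₁ * R', fun f hf x hx e he => ?_⟩
  have hxΩ := interior_subset hx
  have hdet := hf.det_diffMatrix hΩ hxΩ
  have hz : g.gaussMap f x ∈ K :=
    ⟨hxΩ, hf.mapsTo hxΩ, abs_le.1 (Metric.abs_rotCos_le hdet), abs_le.1 (Metric.abs_rotSin_le hdet)⟩
  obtain ⟨h1, h2⟩ := hf.gaussMap_bounds hΩ hr hx he
  rw [lap_comp (hf.contDiffAt_gaussMap hΩ hxΩ) (hΦK _ hz), Fin.sum_univ_two]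
  have hb : ∀ m, fderiv ℝ (fderiv ℝ Φ) (g.gaussMap f x) (fderiv ℝ (g.gaussMap f) x (e m))
      (fderiv ℝ (g.gaussMap f) x (e m)) ≤ M₂ * R * R := fun m => by
    refine (le_abs_self _).trans ?_
    exact ContinuousLinearMap.le_of_opNorm_le_of_le _
      (ContinuousLinearMap.le_of_opNorm_le_of_le _ (hM₂ _ hz) (h1 m)) (h1 m)
  have hb' := (le_abs_self _).trans
    ((fderiv ℝ Φ (g.gaussMap f x)).le_of_opNorm_le_of_le (hM₁ _ hz) h2)
  linarith [hb 0, hb 1]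

end bounds

/-! ### The boundary derivative estimate -/

lemma IsBoundaryDefining.comp_sq {g : Metric} {Ω : Set Plane} {h : Plane → ℝ}
    (hh : IsBoundaryDefining g Ω h) {p : Plane} (hp : p ∈ frontier Ω) :
    g.comp h 0 p ^ 2 + g.comp h 1 p ^ 2 = 1 := by
  have := hh.grad p hp
  rwa [Metric.len, Real.sqrt_eq_one, g.inner_grad] at this

lemma IsBoundaryDefining.fderiv_ne_zero {g : Metric} {Ω : Set Plane} {h : Plane → ℝ}
    (hh : IsBoundaryDefining g Ω h) {p : Plane} (hp : p ∈ frontier Ω) : fderiv ℝ h p ≠ 0 := by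
  intro h0
  have := hh.comp_sq hp
  simp [Metric.comp, h0] at this

section estimates

variable {g : Metric} {Ω Ω' : Set Plane} {h h' : Plane → ℝ} {f : Plane → Plane} {θ : ℝ}

lemma IsMinimalLagrangianDiffeo.le_lap (hf : IsMinimalLagrangianDiffeo g f Ω Ω')
    (hh : IsBoundaryDefining g Ω h)
    (hθ : ∀ p ∈ Ω, ∀ w, θ * g.inner p w w ≤ g.hess h p w w) {x : Plane} (hx : x ∈ interior Ω)
    {e : Fin 2 → Plane} (he : g.IsAdapted f x e) : θ ≤ lap e (g.drift x e) h x := by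
  have hxΩ := interior_subset hx
  have h1 := he.sum_inner ((hf.contDiffAt hxΩ).differentiableAt (by simp))
    (hf.det_diffMatrix_interior hx)
  rw [Metric.drift, lap_eq_hess g (hh.smooth.contDiffAt hxΩ)]
  calc θ = ∑ m, θ * g.inner x (e m) (e m) := by rw [← Finset.mul_sum, h1, mul_one]
    _ ≤ _ := Finset.sum_le_sum fun m _ => hθ x hxΩ (e m)

lemma IsMinimalLagrangianDiffeo.le_lap_comp (hf : IsMinimalLagrangianDiffeo g f Ω Ω')
    (hh' : IsBoundaryDefining g Ω' h')
    (hθ : ∀ p ∈ Ω', ∀ w, θ * g.inner p w w ≤ g.hess h' p w w) {x : Plane} (hx : x ∈ interior Ω)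
    {e : Fin 2 → Plane} (he : g.IsAdapted f x e) :
    θ ≤ lap e (g.drift x e) (fun y => h' (f y)) x := by
  have hxΩ := interior_subset hx
  have hfΩ := hf.mapsTo hxΩ
  have h1 := he.sum_inner_map ((hf.contDiffAt hxΩ).differentiableAt (by simp))
    (hf.det_diffMatrix_interior hx)
  rw [he.lap_comp_map hf.minimal hxΩ (hf.contDiffAt hxΩ) (hh'.smooth.contDiffAt hfΩ)]
  calc θ = ∑ m, θ * g.inner (f x) (fderiv ℝ f x (e m)) (fderiv ℝ f x (e m)) := by
        rw [← Finset.mul_sum, h1, mul_one]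
    _ ≤ _ := Finset.sum_le_sum fun m _ => hθ (f x) hfΩ _

/-- Comparison with a multiple of a function whose Laplacian on the graph is bounded below. -/
lemma le_sub_mul_of_lap_le (hΩ : IsStrictlyConvexDomain g Ω) {φ ψ : Plane → ℝ} {C c : ℝ}
    (hθ : 0 < θ) (hφ : ∀ x ∈ Ω, ContDiffAt ℝ ∞ φ x) (hψ : ∀ x ∈ Ω, ContDiffAt ℝ ∞ ψ x)
    (hφC : ∀ x ∈ interior Ω, ∀ e, g.IsAdapted f x e → lap e (g.drift x e) φ x ≤ C)
    (hψθ : ∀ x ∈ interior Ω, ∀ e, g.IsAdapted f x e → θ ≤ lap e (g.drift x e) ψ x)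
    (hc : ∀ x ∈ frontier Ω, c ≤ φ x) (hψ0 : ∀ x ∈ frontier Ω, ψ x = 0) {x : Plane} (hx : x ∈ Ω) :
    c ≤ φ x - (|C| + 1) / θ * ψ x := by
  refine le_of_lap_neg hΩ.compact (φ := fun y => φ y - (|C| + 1) / θ * ψ y)
    (fun y hy => (hφ y hy).sub (contDiffAt_const.mul (hψ y hy))) (fun y hy => ?_)
    (fun y hy => ?_) hx
  · obtain ⟨e, he⟩ := g.exists_graph_orthonormal f y
    refine ⟨e, g.drift y e, ?_⟩
    rw [lap_sub_const_mul (hφ y (interior_subset hy)) (hψ y (interior_subset hy))]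
    have h1 := hφC y hy e he
    have h2 := hψθ y hy e he
    have h3 : |C| + 1 ≤ (|C| + 1) / θ * lap e (g.drift y e) ψ y := by
      rw [div_mul_eq_mul_div, le_div_iff₀ hθ]
      gcongr
    linarith [le_abs_self C]
  · simp only [hψ0 y hy, mul_zero, sub_zero]
    exact hc y hy

/-- `h` is a strict subsolution with zero boundary values, so comparison with `φ = 0` applies; the
graph of `f` only supplies the operator. -/
lemma IsMinimalLagrangianDiffeo.nonpos (hf : IsMinimalLagrangianDiffeo g f Ω Ω')
    (hΩ : IsStrictlyConvexDomain g Ω) (hh : IsBoundaryDefining g Ω h) {x : Plane} (hx : x ∈ Ω) :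
    h x ≤ 0 := by
  obtain ⟨θ, hθ, hθ'⟩ := hh.uniformlyConvex
  have h1 := le_sub_mul_of_lap_le (f := f) (φ := fun _ => 0) (C := 0) (c := 0) hΩ hθ
    (fun _ _ => contDiffAt_const) (fun y hy => hh.smooth.contDiffAt hy)
    (fun y _ e _ => by simp [lap]) (fun y hy e he => hf.le_lap hh hθ' hy he) (fun _ _ => le_rfl)
    hh.zero hx
  simp only [abs_zero, zero_add, zero_sub] at h1
  have h2 : 0 < 1 / θ := by positivity
  nlinarith

/-- The differentials of `h' ∘ f` and `h` are proportional at the boundary, with a factor that is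
bounded from above and below independently of `f`. -/
lemma exists_boundary_ratio (hΩ : IsStrictlyConvexDomain g Ω)
    (hΩ' : IsStrictlyConvexDomain g Ω') (hh : IsBoundaryDefining g Ω h)
    (hh' : IsBoundaryDefining g Ω' h') :
    ∃ k k' : ℝ, ∀ f, IsMinimalLagrangianDiffeo g f Ω Ω' → ∀ p ∈ frontier Ω,
      ∃ b : ℝ, 0 < b ∧ b ≤ k ∧ 1 ≤ k' * b ∧
        fderiv ℝ (fun y => h' (f y)) p = b • fderiv ℝ h p := by
  obtain ⟨θ, hθ, hconv⟩ := hh.uniformlyConvex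
  obtain ⟨θ', hθ', hconv'⟩ := hh'.uniformlyConvex
  obtain ⟨C, hC⟩ := exists_lap_bound (Φ := fun z => h' z.2.1) hΩ hΩ'.compact
    fun x _ y hy c s => (hh'.smooth.contDiffAt hy).comp (x, y, c, s)
      (contDiff_fst.comp contDiff_snd).contDiffAt
  obtain ⟨C', hC'⟩ := exists_lap_bound (Φ := fun z => h z.1) hΩ hΩ'.compact
    fun x hx y _ c s => (hh.smooth.contDiffAt hx).comp (x, y, c, s) contDiff_fst.contDiffAt
  refine ⟨(|C| + 1) / θ, (|C'| + 1) / θ', fun f hf p hp => ?_⟩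
  set k := (|C| + 1) / θ
  set k' := (|C'| + 1) / θ'
  have hk' : 0 < k' := by positivity
  have hpΩ := hΩ.frontier_subset hp
  have hs : ∀ x ∈ Ω, ContDiffAt ℝ ∞ h x := fun x hx => hh.smooth.contDiffAt hx
  have hs' : ∀ x ∈ Ω, ContDiffAt ℝ ∞ (fun y => h' (f y)) x := fun x hx =>
    (hh'.smooth.contDiffAt (hf.mapsTo hx)).comp x (hf.contDiffAt hx)
  have hz' : ∀ x ∈ frontier Ω, h' (f x) = 0 := fun x hx =>
    hh'.zero _ (hf.diffeo.mem_frontier (hΩ.frontier_subset hx) hx)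
  -- Each of `h` and `h' ∘ f` has `lap` bounded above and bounded below by a positive constant, so
  -- each serves as barrier for the other.
  have hcmp : ∀ x ∈ Ω, 0 ≤ h' (f x) - k * h x := fun x hx =>
    le_sub_mul_of_lap_le (f := f) (φ := fun y => h' (f y)) hΩ hθ hs' hs (hC f hf)
      (fun y hy e he => hf.le_lap hh hconv hy he) (fun y hy => (hz' y hy).ge) hh.zero hx
  have hcmp' : ∀ x ∈ Ω, 0 ≤ h x - k' * h' (f x) := fun x hx =>
    le_sub_mul_of_lap_le (f := f) (ψ := fun y => h' (f y)) hΩ hθ' hs hs' (hC' f hf)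
      (fun y hy e he => hf.le_lap_comp hh' hconv' hy he) (fun y hy => (hh.zero y hy).ge) hz' hx
  have hd : DifferentiableAt ℝ h p := (hs p hpΩ).differentiableAt (by simp)
  have hd' : DifferentiableAt ℝ (fun y => h' (f y)) p := (hs' p hpΩ).differentiableAt (by simp)
  have hmax : ∀ x ∈ Ω, h x ≤ h p := fun x hx => by
    rw [hh.zero p hp]; exact hf.nonpos hΩ hh hx
  have hne := hh.fderiv_ne_zero hp
  obtain ⟨μ, hμ, h1⟩ := hΩ.exists_fderiv_eq hp hd hne hmax (hd'.fun_sub (hd.const_mul k))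
    fun x hx => by simpa [hh.zero p hp, hz' p hp] using hcmp x hx
  obtain ⟨μ', hμ', h2⟩ := hΩ.exists_fderiv_eq hp hd hne hmax (hd.fun_sub (hd'.const_mul k'))
    fun x hx => by simpa [hh.zero p hp, hz' p hp] using hcmp' x hx
  rw [fderiv_fun_sub hd' (hd.const_mul k), fderiv_const_mul hd] at h1
  rw [fderiv_fun_sub hd (hd'.const_mul k'), fderiv_const_mul hd'] at h2
  -- The factor is `b = k - μ ≤ k`. The reverse comparison gives `k' b = 1 + μ' ≥ 1`, which also
  -- forces `b > 0`.
  have hb : fderiv ℝ (fun y => h' (f y)) p = (k - μ) • fderiv ℝ h p := by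
    rw [sub_eq_iff_eq_add.1 h1]
    module
  have hkb : k' * (k - μ) = 1 + μ' := by
    rw [hb] at h2
    have h3 : (1 + μ' - k' * (k - μ)) • fderiv ℝ h p = 0 := by
      have h4 := sub_eq_zero.2 h2
      rw [← h4]
      module
    have := (smul_eq_zero.1 h3).resolve_right hne
    linarith
  refine ⟨k - μ, ?_, by linarith, by linarith, hb⟩
  by_contra! hle
  nlinarith

end estimates

/-! ### Obliqueness -/

/-- The inner product of the rotated gradient of `h` with the gradient of `h'`. -/
def Metric.obliqueness (g : Metric) (h h' : Plane → ℝ) (z : Plane × Plane × ℝ × ℝ) : ℝ :=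
  z.2.2.1 * (g.comp h 0 z.1 * g.comp h' 0 z.2.1 + g.comp h 1 z.1 * g.comp h' 1 z.2.1)
    + z.2.2.2 * (g.comp h 0 z.1 * g.comp h' 1 z.2.1 - g.comp h 1 z.1 * g.comp h' 0 z.2.1)

lemma Metric.contDiffAt_obliqueness (g : Metric) {h h' : Plane → ℝ} {x y : Plane}
    (hh : ContDiffAt ℝ ∞ h x) (hh' : ContDiffAt ℝ ∞ h' y) (c s : ℝ) :
    ContDiffAt ℝ ∞ (g.obliqueness h h') (x, y, c, s) := by
  have h1 : ∀ b, ContDiffAt ℝ ∞ (fun z : Plane × Plane × ℝ × ℝ => g.comp h b z.1) (x, y, c, s) :=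
    fun b => (g.contDiffAt_comp b hh).comp (x, y, c, s) contDiff_fst.contDiffAt
  have h2 : ∀ b, ContDiffAt ℝ ∞ (fun z : Plane × Plane × ℝ × ℝ => g.comp h' b z.2.1)
      (x, y, c, s) := fun b => (g.contDiffAt_comp b hh').comp (x, y, c, s)
    (contDiff_fst.comp contDiff_snd).contDiffAt
  have h3 : ContDiffAt ℝ ∞ (fun z : Plane × Plane × ℝ × ℝ => z.2.2.1) (x, y, c, s) :=
    (contDiff_fst.comp (contDiff_snd.comp contDiff_snd)).contDiffAt
  have h4 : ContDiffAt ℝ ∞ (fun z : Plane × Plane × ℝ × ℝ => z.2.2.2) (x, y, c, s) :=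
    (contDiff_snd.comp (contDiff_snd.comp contDiff_snd)).contDiffAt
  exact (h3.mul (((h1 0).mul (h2 0)).add ((h1 1).mul (h2 1)))).add
    (h4.mul (((h1 0).mul (h2 1)).sub ((h1 1).mul (h2 0))))

section obliqueness

variable {g : Metric} {Ω Ω' : Set Plane} {h h' : Plane → ℝ} {f : Plane → Plane} {x : Plane}

/-- The vector with components `(a, b)` in the orthonormal frame at `x`. -/
def Metric.ofComp (g : Metric) (x : Plane) (a b : ℝ) : Plane :=
  a • (fun k => g.frame x k 0) + b • (fun k => g.frame x k 1)

lemma Metric.coframe_ofComp (g : Metric) (x : Plane) (a b : ℝ) :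
    g.coframe x *ᵥ g.ofComp x a b = ![a, b] := by
  have hE : ∀ i j, (g.coframe x *ᵥ fun k => g.frame x k j) i = (1 : Matrix (Fin 2) (Fin 2) ℝ) i j :=
    fun i j => congrFun (congrFun (g.coframe_mul_frame x) i) j
  rw [Metric.ofComp, Matrix.mulVec_add, Matrix.mulVec_smul, Matrix.mulVec_smul]
  ext i
  simp only [Pi.add_apply, Pi.smul_apply, hE]
  obtain rfl | rfl : i = 0 ∨ i = 1 := by omega
  all_goals simp

lemma Metric.inner_ofComp (g : Metric) (x : Plane) (a b : ℝ) :
    g.inner x (g.ofComp x a b) (g.ofComp x a b) = a ^ 2 + b ^ 2 := by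
  rw [g.inner_eq, g.coframe_ofComp]
  simp [dotProduct, Fin.sum_univ_two]
  ring

lemma Metric.eq_ofComp (g : Metric) (x v : Plane) :
    v = g.ofComp x ((g.coframe x *ᵥ v) 0) ((g.coframe x *ᵥ v) 1) :=
  g.sum_frame_coframe x v

/-- The derivative of the obliqueness, with the rotation `R` being parallel: it is
`Hess h (v, R* ∇h') + Hess h' (Df v, R ∇h)`. -/
lemma IsMinimalLagrangianDiffeo.fderiv_obliqueness (hf : IsMinimalLagrangianDiffeo g f Ω Ω')
    (hΩ : IsStrictlyConvexDomain g Ω) (hh : IsBoundaryDefining g Ω h)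
    (hh' : IsBoundaryDefining g Ω' h') (hx : x ∈ Ω) (v : Plane) :
    fderiv ℝ (fun y => g.obliqueness h h' (g.gaussMap f y)) x v
      = g.hess h x v (g.ofComp x
          (g.rotCos f x * g.comp h' 0 (f x) + g.rotSin f x * g.comp h' 1 (f x))
          (g.rotCos f x * g.comp h' 1 (f x) - g.rotSin f x * g.comp h' 0 (f x)))
        + g.hess h' (f x) (fderiv ℝ f x v) (g.ofComp (f x)
          (g.rotCos f x * g.comp h 0 x - g.rotSin f x * g.comp h 1 x)
          (g.rotSin f x * g.comp h 0 x + g.rotCos f x * g.comp h 1 x)) := by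
  have hfx := hf.contDiffAt hx
  have hdet := hf.det_diffMatrix hΩ hx
  have hfd : DifferentiableAt ℝ f x := hfx.differentiableAt (by simp)
  have hc : DifferentiableAt ℝ (g.rotCos f) x :=
    (Metric.contDiffAt_rotCos hfx hdet).differentiableAt (by simp)
  have hs : DifferentiableAt ℝ (g.rotSin f) x :=
    (Metric.contDiffAt_rotSin hfx hdet).differentiableAt (by simp)
  have hhx := hh.smooth.contDiffAt hx
  have hhx' := hh'.smooth.contDiffAt (hf.mapsTo hx)
  have ha : ∀ b, DifferentiableAt ℝ (g.comp h b) x := fun b =>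
    (g.contDiffAt_comp b hhx).differentiableAt (by simp)
  have ha' : ∀ b, DifferentiableAt ℝ (g.comp h' b) (f x) := fun b =>
    (g.contDiffAt_comp b hhx').differentiableAt (by simp)
  have hk : ∀ b, DifferentiableAt ℝ (fun y => g.comp h' b (f y)) x := fun b =>
    (ha' b).comp x hfd
  have hkd : ∀ b, fderiv ℝ (fun y => g.comp h' b (f y)) x v
      = fderiv ℝ (g.comp h' b) (f x) (fderiv ℝ f x v) := fun b => by
    have : fderiv ℝ (fun y => g.comp h' b (f y)) x
        = fderiv ℝ (g.comp h' b) (f x) ∘L fderiv ℝ f x := fderiv_comp x (ha' b) hfd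
    rw [this]
    rfl
  have hrot := hf.fderiv_rot hΩ hx v
  have h1 := g.fderiv_comp hhx v
  have h2 := g.fderiv_comp hhx' (fderiv ℝ f x v)
  change fderiv ℝ (fun y => g.rotCos f y * (g.comp h 0 y * g.comp h' 0 (f y)
    + g.comp h 1 y * g.comp h' 1 (f y)) + g.rotSin f y * (g.comp h 0 y * g.comp h' 1 (f y)
    - g.comp h 1 y * g.comp h' 0 (f y))) x v = _
  rw [fderiv_fun_add (hc.fun_mul (((ha 0).fun_mul (hk 0)).fun_add ((ha 1).fun_mul (hk 1))))
      (hs.fun_mul (((ha 0).fun_mul (hk 1)).fun_sub ((ha 1).fun_mul (hk 0)))),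
    fderiv_fun_mul hc (((ha 0).fun_mul (hk 0)).fun_add ((ha 1).fun_mul (hk 1))),
    fderiv_fun_mul hs (((ha 0).fun_mul (hk 1)).fun_sub ((ha 1).fun_mul (hk 0))),
    fderiv_fun_add ((ha 0).fun_mul (hk 0)) ((ha 1).fun_mul (hk 1)),
    fderiv_fun_sub ((ha 0).fun_mul (hk 1)) ((ha 1).fun_mul (hk 0)),
    fderiv_fun_mul (ha 0) (hk 0), fderiv_fun_mul (ha 1) (hk 1), fderiv_fun_mul (ha 0) (hk 1),
    fderiv_fun_mul (ha 1) (hk 0)]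
  simp only [_root_.add_apply, _root_.sub_apply, _root_.smul_apply, smul_eq_mul, hkd, hrot.1,
    hrot.2, h1.1, h1.2, h2.1, h2.2, Metric.ofComp, g.hess_add_smul]
  ring

/-- Proportionality of the differentials of `h' ∘ f` and `h`, in orthonormal frames. -/
lemma Metric.comp_of_fderiv_eq (hfd : DifferentiableAt ℝ f x)
    (hh' : DifferentiableAt ℝ h' (f x)) {b : ℝ}
    (hb : fderiv ℝ (fun y => h' (f y)) x = b • fderiv ℝ h x) (j : Fin 2) :
    g.comp h' 0 (f x) * g.diffMatrix f x 0 j + g.comp h' 1 (f x) * g.diffMatrix f x 1 j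
      = b * g.comp h j x := by
  have h1 : fderiv ℝ (fun y => h' (f y)) x = fderiv ℝ h' (f x) ∘L fderiv ℝ f x :=
    _root_.fderiv_comp x hh' hfd
  have h2 := congrArg (fun l : Plane →L[ℝ] ℝ => l (fun k => g.frame x k j)) (h1.symm.trans hb)
  simp only [ContinuousLinearMap.comp_apply, _root_.smul_apply, smul_eq_mul] at h2
  rw [g.fderiv_eq_comp h' (f x), ← g.diffMatrix_mulVec hfd] at h2
  have hE : (g.coframe x *ᵥ fun k => g.frame x k j) = fun i => (1 : Matrix (Fin 2) (Fin 2) ℝ) i j :=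
    funext fun i => congrFun (congrFun (g.coframe_mul_frame x) i) j
  rw [hE] at h2
  change _ = b * g.comp h j x at h2
  rw [← h2]
  obtain rfl | rfl : j = 0 ∨ j = 1 := by omega
  all_goals simp [Matrix.mulVec, dotProduct, Fin.sum_univ_two]

/-- At a boundary point, `Df` maps `R* ∇h'` to a multiple of `R ∇h`. -/
lemma Metric.fderiv_ofComp (hfd : DifferentiableAt ℝ f x)
    (hh' : DifferentiableAt ℝ h' (f x)) {b : ℝ}
    (hb : fderiv ℝ (fun y => h' (f y)) x = b • fderiv ℝ h x) :
    fderiv ℝ f x (g.ofComp x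
        (g.rotCos f x * g.comp h' 0 (f x) + g.rotSin f x * g.comp h' 1 (f x))
        (g.rotCos f x * g.comp h' 1 (f x) - g.rotSin f x * g.comp h' 0 (f x)))
      = b • g.ofComp (f x) (g.rotCos f x * g.comp h 0 x - g.rotSin f x * g.comp h 1 x)
        (g.rotSin f x * g.comp h 0 x + g.rotCos f x * g.comp h 1 x) := by
  have h0 := Metric.comp_of_fderiv_eq (g := g) hfd hh' hb 0
  have h1 := Metric.comp_of_fderiv_eq (g := g) hfd hh' hb 1
  -- This is the symmetry of `RᵀF`, hence of `F Rᵀ`. Combined with `Fᵀν' = b ν` it gives `F Rᵀν' = R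
  -- Fᵀν' = b Rν`.
  have hpar : g.rotSin f x * (g.diffMatrix f x 0 0 + g.diffMatrix f x 1 1)
      = g.rotCos f x * (g.diffMatrix f x 1 0 - g.diffMatrix f x 0 1) := by
    change g.rotSin f x * g.confRe f x = g.rotCos f x * g.confIm f x
    rw [Metric.rotSin, Metric.rotCos]
    ring
  rw [g.eq_ofComp (f x) (fderiv ℝ f x _), ← g.diffMatrix_mulVec hfd, g.coframe_ofComp]
  simp only [Metric.ofComp, smul_add, smul_smul]
  congr 2
  · simp [Matrix.mulVec, dotProduct, Fin.sum_univ_two]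
    linear_combination g.comp h' 1 (f x) * hpar + g.rotCos f x * h0 - g.rotSin f x * h1
  · simp [Matrix.mulVec, dotProduct, Fin.sum_univ_two]
    linear_combination -g.comp h' 0 (f x) * hpar + g.rotSin f x * h0 + g.rotCos f x * h1

/-- Since `det F = 1`, `confAbs · R = F + F⁻ᵀ`. With `Fᵀν' = b ν` and unit `ν`, `ν'`, pairing `Fν`
with `ν'` gives `b` and pairing `F⁻ᵀν` with `ν'` gives `1 / b`. -/
lemma Metric.confAbs_mul_obliqueness (hfd : DifferentiableAt ℝ f x)
    (hdet : (g.diffMatrix f x).det = 1) (hh' : DifferentiableAt ℝ h' (f x)) {b : ℝ}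
    (hb : fderiv ℝ (fun y => h' (f y)) x = b • fderiv ℝ h x)
    (hsq : g.comp h 0 x ^ 2 + g.comp h 1 x ^ 2 = 1)
    (hsq' : g.comp h' 0 (f x) ^ 2 + g.comp h' 1 (f x) ^ 2 = 1) :
    b * (g.confAbs f x * g.obliqueness h h' (g.gaussMap f x)) = 1 + b ^ 2 := by
  have h0 := Metric.comp_of_fderiv_eq (g := g) hfd hh' hb 0
  have h1 := Metric.comp_of_fderiv_eq (g := g) hfd hh' hb 1
  have hobl : g.confAbs f x * g.obliqueness h h' (g.gaussMap f x)
      = g.confRe f x * (g.comp h 0 x * g.comp h' 0 (f x) + g.comp h 1 x * g.comp h' 1 (f x))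
        + g.confIm f x * (g.comp h 0 x * g.comp h' 1 (f x) - g.comp h 1 x * g.comp h' 0 (f x)) := by
    rw [← Metric.rotCos_mul hdet, ← Metric.rotSin_mul hdet]
    simp only [Metric.obliqueness, Metric.gaussMap]
    ring
  rw [hobl, Metric.confRe, Metric.confIm]
  rw [Matrix.det_fin_two] at hdet
  have e0 : b ^ 2 = (b * g.comp h 0 x) ^ 2 + (b * g.comp h 1 x) ^ 2 := by
    linear_combination -b ^ 2 * hsq
  have e1 : b * ((g.diffMatrix f x 0 0 + g.diffMatrix f x 1 1)
        * (g.comp h 0 x * g.comp h' 0 (f x) + g.comp h 1 x * g.comp h' 1 (f x))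
        + (g.diffMatrix f x 1 0 - g.diffMatrix f x 0 1)
        * (g.comp h 0 x * g.comp h' 1 (f x) - g.comp h 1 x * g.comp h' 0 (f x)))
      = (g.diffMatrix f x 0 0 + g.diffMatrix f x 1 1)
        * (b * g.comp h 0 x * g.comp h' 0 (f x) + b * g.comp h 1 x * g.comp h' 1 (f x))
        + (g.diffMatrix f x 1 0 - g.diffMatrix f x 0 1)
        * (b * g.comp h 0 x * g.comp h' 1 (f x) - b * g.comp h 1 x * g.comp h' 0 (f x)) := by
    ring
  rw [e0, e1, ← h0, ← h1]
  linear_combination (g.comp h' 0 (f x) ^ 2 + g.comp h' 1 (f x) ^ 2) * hdet + hsq'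

end obliqueness

/-- A uniform lower bound for the obliqueness at the boundary. -/
lemma exists_obliqueness_bound {g : Metric} {Ω Ω' : Set Plane} {h h' : Plane → ℝ}
    (hΩ : IsStrictlyConvexDomain g Ω) (hΩ' : IsStrictlyConvexDomain g Ω')
    (hh : IsBoundaryDefining g Ω h) (hh' : IsBoundaryDefining g Ω' h') :
    ∃ δ > 0, ∀ f, IsMinimalLagrangianDiffeo g f Ω Ω' → ∀ p ∈ frontier Ω,
      δ ≤ g.obliqueness h h' (g.gaussMap f p) := by
  obtain ⟨θ, hθ, hconv⟩ := hh.uniformlyConvex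
  obtain ⟨θ', hθ', hconv'⟩ := hh'.uniformlyConvex
  obtain ⟨k, k', hratio⟩ := exists_boundary_ratio hΩ hΩ' hh hh'
  obtain ⟨C, hC⟩ := exists_lap_bound (Φ := g.obliqueness h h') hΩ hΩ'.compact
    fun x hx y hy c s => g.contDiffAt_obliqueness (hh.smooth.contDiffAt hx)
      (hh'.smooth.contDiffAt hy) c s
  set K := (|C| + 1) / θ with hK
  have hKpos : 0 < K := by positivity
  refine ⟨θ / K, by positivity, fun f hf p hp => ?_⟩
  set χ : Plane → ℝ := fun y => g.obliqueness h h' (g.gaussMap f y) with hχ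
  have hχs : ∀ x ∈ Ω, ContDiffAt ℝ ∞ χ x := fun x hx =>
    ContDiffAt.comp (g := g.obliqueness h h') x (g.contDiffAt_obliqueness
      (hh.smooth.contDiffAt hx) (hh'.smooth.contDiffAt (hf.mapsTo hx)) _ _)
      (hf.contDiffAt_gaussMap hΩ hx)
  -- It suffices to bound `χ` at its minimum `q` over the compact boundary.
  obtain ⟨q, hq, hqmin⟩ := (hΩ.compact.of_isClosed_subset isClosed_frontier
    hΩ.frontier_subset).exists_isMinOn ⟨p, hp⟩ (f := χ)
    fun x hx => (hχs x (hΩ.frontier_subset hx)).continuousAt.continuousWithinAt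
  refine le_trans ?_ (hqmin hp)
  have hqΩ := hΩ.frontier_subset hq
  have hcmp : ∀ x ∈ Ω, χ q ≤ χ x - K * h x := fun x hx =>
    le_sub_mul_of_lap_le (f := f) (φ := χ) hΩ hθ hχs (fun y hy => hh.smooth.contDiffAt hy)
      (hC f hf) (fun y hy e he => hf.le_lap hh hconv hy he) (fun y hy => hqmin hy) hh.zero hx
  have hd : DifferentiableAt ℝ h q := (hh.smooth.contDiffAt hqΩ).differentiableAt (by simp)
  have hd' : DifferentiableAt ℝ h' (f q) :=
    (hh'.smooth.contDiffAt (hf.mapsTo hqΩ)).differentiableAt (by simp)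
  have hfd : DifferentiableAt ℝ f q := (hf.contDiffAt hqΩ).differentiableAt (by simp)
  have hχd : DifferentiableAt ℝ χ q := (hχs q hqΩ).differentiableAt (by simp)
  -- As `h q = 0`, the function `χ - K h` attains its minimum over `Ω` at `q`, so `dχ = (K - μ) dh`
  -- there.
  obtain ⟨μ, hμ, hder⟩ := hΩ.exists_fderiv_eq hq hd (hh.fderiv_ne_zero hq)
    (fun x hx => by rw [hh.zero q hq]; exact hf.nonpos hΩ hh hx)
    (hχd.fun_sub (hd.const_mul K)) fun x hx => by simpa [hh.zero q hq] using hcmp x hx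
  rw [fderiv_fun_sub hχd (hd.const_mul K), fderiv_const_mul hd] at hder
  obtain ⟨b, hb, -, -, hbd⟩ := hratio f hf q hq
  have hdet := hf.det_diffMatrix hΩ hqΩ
  have hsq := hh.comp_sq hq
  have hsq' := hh'.comp_sq (hf.diffeo.mem_frontier hqΩ hq)
  have hrot := Metric.rot_sq hdet
  -- `w = Rᵀν'` and `u = Rν`. Since `Df w = b u`, both Hessians in `dχ(w)` are evaluated on the
  -- diagonal, where convexity applies.
  set w := g.ofComp q (g.rotCos f q * g.comp h' 0 (f q) + g.rotSin f q * g.comp h' 1 (f q))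
    (g.rotCos f q * g.comp h' 1 (f q) - g.rotSin f q * g.comp h' 0 (f q)) with hw
  set u := g.ofComp (f q) (g.rotCos f q * g.comp h 0 q - g.rotSin f q * g.comp h 1 q)
    (g.rotSin f q * g.comp h 0 q + g.rotCos f q * g.comp h 1 q) with hu
  have hwn : g.inner q w w = 1 := by
    rw [hw, g.inner_ofComp]
    linear_combination (g.comp h' 0 (f q) ^ 2 + g.comp h' 1 (f q) ^ 2) * hrot + hsq'
  have hχw : fderiv ℝ χ q w = g.hess h q w w + b * g.hess h' (f q) u u := by
    rw [hχ, hf.fderiv_obliqueness hΩ hh hh' hqΩ, ← hw, ← hu, hw,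
      Metric.fderiv_ofComp hfd hd' hbd, ← hw, ← hu, g.hess_smul_left]
  have hhw : fderiv ℝ h q w = χ q := by
    rw [g.fderiv_eq_comp, hw, g.coframe_ofComp]
    simp only [hχ, Metric.obliqueness, Metric.gaussMap, Matrix.cons_val_zero, Matrix.cons_val_one]
    ring
  have hlow : θ ≤ fderiv ℝ χ q w := by
    rw [hχw]
    have h1 := hconv q hqΩ w
    have h2 := hconv' (f q) (hf.mapsTo hqΩ) u
    have h3 := g.inner_self_nonneg (f q) u
    have h4 : 0 ≤ b * g.hess h' (f q) u u := mul_nonneg hb.le (le_trans (by positivity) h2)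
    rw [hwn, mul_one] at h1
    linarith
  have hup : fderiv ℝ χ q w = (K - μ) * χ q := by
    have h1 := congrArg (fun l : Plane →L[ℝ] ℝ => l w) hder
    simp only [_root_.sub_apply, _root_.smul_apply, smul_eq_mul, hhw] at h1
    linarith
  -- Positivity comes from `b · confAbs · χ = 1 + b²` with `b` and `confAbs` positive. It allows the
  -- term `-μ χ` to be discarded from `θ ≤ (K - μ) χ`.
  have hpos : 0 < χ q := by
    have h1 := Metric.confAbs_mul_obliqueness hfd hdet hd' hbd hsq hsq'
    have h2 := Metric.confAbs_pos hdet
    by_contra! hle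
    have h3 : g.confAbs f q * χ q ≤ 0 := mul_nonpos_of_nonneg_of_nonpos h2.le hle
    have h4 : b * (g.confAbs f q * χ q) ≤ 0 := mul_nonpos_of_nonneg_of_nonpos hb.le h3
    nlinarith [sq_nonneg b]
  rw [div_le_iff₀ hKpos]
  nlinarith [mul_nonneg hμ hpos.le]

end MinLag

end

/-- The estimate holds for any smooth metric: the curvature and completeness hypotheses `hg` are not
needed, since the rotation in the polar decomposition of `Df` is parallel for every metric. -/
theorem mainTheorem6 (g : MinLag.Metric) (κ : ℝ) (hg : g.IsSpaceForm κ)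
    (Ω Ω' : Set MinLag.Plane)
    (hΩ : MinLag.IsStrictlyConvexDomain g Ω) (hΩ' : MinLag.IsStrictlyConvexDomain g Ω')
    (h h' : MinLag.Plane → ℝ)
    (hh : MinLag.IsBoundaryDefining g Ω h) (hh' : MinLag.IsBoundaryDefining g Ω' h') :
    ∃ C₃ : ℝ, ∀ f : MinLag.Plane → MinLag.Plane,
      MinLag.IsMinimalLagrangianDiffeo g f Ω Ω' →
      ∀ p ∈ frontier Ω,
        (1 + g.jacAdj f p * MinLag.jac f p).det ≤ C₃ := by
  obtain ⟨k, k', hratio⟩ := MinLag.exists_boundary_ratio hΩ hΩ' hh hh'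
  obtain ⟨δ, hδ, hobl⟩ := MinLag.exists_obliqueness_bound hΩ hΩ' hh hh'
  -- The constant reflects `confAbs = (b + 1 / b) / χ` with `b ≤ k`, `1 / b ≤ k'` and `χ ≥ δ`.
  refine ⟨((k + k') / δ) ^ 2, fun f hf p hp => ?_⟩
  have hpΩ := hΩ.frontier_subset hp
  have hdet := hf.det_diffMatrix hΩ hpΩ
  rw [g.det_one_add_jacAdj, MinLag.Metric.det_one_add_eq hdet]
  obtain ⟨b, hb, hbk, hbk', hbd⟩ := hratio f hf p hp
  have hχ := hobl f hf p hp
  have hid := MinLag.Metric.confAbs_mul_obliqueness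
    ((hf.contDiffAt hpΩ).differentiableAt (by simp)) hdet
    ((hh'.smooth.contDiffAt (hf.mapsTo hpΩ)).differentiableAt (by simp)) hbd (hh.comp_sq hp)
    (hh'.comp_sq (hf.diffeo.mem_frontier hpΩ hp))
  have ht := MinLag.Metric.confAbs_pos hdet
  refine pow_le_pow_left₀ ht.le ?_ 2
  rw [le_div_iff₀ hδ]
  have h1 : g.confAbs f p * δ ≤ g.confAbs f p * g.obliqueness h h' (g.gaussMap f p) := by gcongr
  refine h1.trans (le_of_mul_le_mul_left ?_ hb)
  rw [hid]
  -- `1 + b² ≤ b (k + k')`, from `1 ≤ k' b` and `b² ≤ k b`.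
  nlinarith
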